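/- For every real $\eta>0$ there exists $n_0$ such that for every even $n\ge n_0$ the following holds. Let $G$ be a finite simple graph on $(2+\eta)n$ vertices (where $(2+\eta)n$ may be rounded up or down to an integer, i.e. the number $N$ of vertices satisfies $|N-(2+\eta)n|<1$) whose minimum degree satisfies $\delta(G)\ge (7/4+4\eta)n$. Then for each colouring of the edges of $G$ with three colours there is a colour $i$ and a connected component $F$ of the spanning subgraph $G_i$ of $G$ formed by all edges of colour $i$, such that $F$ contains a matching which saturates $n$ vertices (i.e. a matching with $n/2$ edges, all of them edges of $F$). -/

import Mathlib

/-! ### Labels of vertices and the inequalities that they satisfy -/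

namespace ThreeColour

/-! Suppose that in each colour every matching inside a component saturates fewer than `n` vertices.
Fix `L` of order `η n`, let `ω` exceed `n` by a bounded error term, and take a set `s` of `2ω + 1`
vertices. The claim is that each colour then has a rigid structure on `s`, and that three such
structures cannot together cover almost all edges of so dense a graph.

If all components of a colour meet `s` in at most `ω` vertices, they can be grouped into three
unions `T, U, K`, the largest of which, `K`, has at most `ω` vertices in `s`
(`exists_labelling_of_small`). Otherwise some component `F` has more than `ω` vertices in `s`, so at
most `ω` of them (label `K`) lie outside `F`. The Tutte–Berge formula inside `F` gives a deleted set
`S`, the vertices `T` in remaining components of fewer than `L` vertices, and the vertices `U` in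
larger ones, with `2|S| + |U| ≤ ω` (`exists_tutteBerge_labels`). The edges inside `T` are discarded,
which costs at most `L` at each vertex. All other edges of the colour join related labels.

Two vertices unrelated in all three colours are thus nonadjacent or joined by a discarded edge.
Since `(2 + η) - (7/4 + 4η) = 1/4 - 3η`, and the discarded edges use only about half of the slack
`3η`, every vertex is unrelated to at most `ω/4` vertices. The result is a `Config`, whose parameter
`n` is this `ω`.

That no configuration exists (`not_config`) is a finite statement about the sizes of the 64 classes
of vertices with given label triples. A case analysis asks whether certain products of label sets
contain a vertex. If one does, all vertices unrelated to the whole product number at most `n/4`.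
Each final case is a linear system refuted by nonnegative multipliers. `false_of_check` proves that
the checker for such case analyses is sound, and four trees, one for each number of colours with a
large component, are evaluated. -/

/-- Two labels of a colour are related when vertices carrying them may be joined in that colour.
The labels `0, 1, 2, 3` are called `S, T, U, K`.  If `big` holds then `S, T, U` are the parts of a
Tutte–Berge decomposition of one large component and `K` is everything else; otherwise `T, U, K`
are three unions of components. -/
def rel (big : Bool) (a b : ℕ) : Bool :=
  if big then
    if a = 0 ∨ b = 0 then a ≠ 3 ∧ b ≠ 3 else a = b ∧ a ≠ 1
  else a = b

/-- The number of vertices whose label is `a`. -/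
def cnt {W : Type*} [Fintype W] (f : W → ℕ) (a : ℕ) : ℕ := (Finset.univ.filter (f · = a)).card

/-- A labelling of the vertices for each of three colours; the first `k` colours have a large
component. -/
structure Config (W : Type*) [Fintype W] (n k : ℕ) (l : Fin 3 → W → ℕ) : Prop where
  card : Fintype.card W = 2 * n + 1
  lt : ∀ i v, l i v < 4
  cover : ∀ i : Fin 3, i.val < k → 2 * cnt (l i) 0 + cnt (l i) 2 ≤ n
  le : ∀ i : Fin 3, cnt (l i) 3 ≤ n
  ne_zero : ∀ i : Fin 3, ¬ i.val < k → ∀ v, l i v ≠ 0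
  le_one : ∀ i : Fin 3, ¬ i.val < k → cnt (l i) 1 ≤ cnt (l i) 3
  le_two : ∀ i : Fin 3, ¬ i.val < k → cnt (l i) 2 ≤ cnt (l i) 3
  missing : ∀ v, 4 * (Finset.univ.filter
    fun w => ∀ i : Fin 3, rel (decide (i.val < k)) (l i v) (l i w) = false).card ≤ n

/-! ### The checker -/

/-- The `c`-th bit of `m`, as a number. -/
def bit (m c : ℕ) : ℕ := Nat.land (Nat.shiftRight m c) 1

/-- The number coding a triple of labels. -/
def code (a b c : ℕ) : ℕ := 16 * a + 4 * b + c

/-- Replaces each of the four bits of `a` by a block of equal bits, where `b` is `2` to the length of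
a block. -/
def spread (b a : ℕ) : ℕ :=
  (b - 1) * (bit a 0 + b * (bit a 1 + b * (bit a 2 + b * bit a 3)))

/-- The set of codes of the triples in a product of three sets of labels.  A set of labels is
coded by four bits, and the product by the hexadecimal number with these digits. -/
def prodMask (q : ℕ) : ℕ :=
  Nat.land (spread 0x10000 (q / 256 % 16))
    (Nat.land (spread 0x10 (q / 16 % 16) * 0x0001000100010001) ((q % 16) * 0x1111111111111111))

/-- The labels not related to any label of a set. -/
def unrel (big : Bool) (a : ℕ) : ℕ :=
  if big then
    Nat.land (15 - 7 * bit a 0) (Nat.land (15 - bit a 1)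
      (Nat.land (15 - 5 * bit a 2) (15 - 8 * bit a 3)))
  else 15 - a

/-- The product of the sets of labels not related to any label in the factors of a product. -/
def unrelProd (k q : ℕ) : ℕ :=
  256 * unrel (Nat.blt 0 k) (q / 256 % 16) + 16 * unrel (Nat.blt 1 k) (q / 16 % 16)
    + unrel (Nat.blt 2 k) (q % 16)

/-- The linear inequality `w * |A| + |B| ≤ |N| + r * n` between sizes of sets of codes. -/
structure Row where
  (w A B N r : ℕ)

/-- The set of codes with label `a` in colour `i`. -/
def labelMask (i a : ℕ) : ℕ :=
  prodMask (match i with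
    | 0 => 256 * 2 ^ a + 255
    | 1 => 3840 + 16 * 2 ^ a + 15
    | _ => 4080 + 2 ^ a)

/-- The inequalities that hold for the labels of colour `i`. -/
def colourRows (k i : ℕ) : List Row :=
  if Nat.blt i k then
    [⟨2, labelMask i 0, labelMask i 2, 0, 1⟩, ⟨1, labelMask i 3, 0, 0, 1⟩]
  else
    [⟨1, labelMask i 3, 0, 0, 1⟩, ⟨1, labelMask i 1, 0, labelMask i 3, 0⟩,
      ⟨1, labelMask i 2, 0, labelMask i 3, 0⟩]

/-- The inequalities of a configuration, preceded by `4 * |M| ≤ n` for the sets `M` in `C`. -/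
def allRows (k : ℕ) (C : List ℕ) : List Row :=
  C.map (fun M => ⟨4, M, 0, 0, 1⟩) ++ (colourRows k 0 ++ (colourRows k 1 ++ colourRows k 2))

/-- The inequalities with nonzero multipliers, and these multipliers.  The multipliers are the digits
of `m` in base `128`. -/
def select : List Row → ℕ → List (ℕ × Row)
  | [], _ => []
  | R :: L, m =>
    bif Nat.beq (Nat.mod m 128) 0 then select L (Nat.div m 128)
    else (Nat.mod m 128, R) :: select L (Nat.div m 128)

/-- The coefficient of `c` on the left side of a combination of inequalities. -/
def lhs : List (ℕ × Row) → ℕ → ℕ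
  | [], _ => 0
  | (a, R) :: L, c => Nat.add (Nat.mul a (Nat.add (Nat.mul R.w (bit R.A c)) (bit R.B c))) (lhs L c)

/-- The coefficient of `c` on the right side of a combination of inequalities. -/
def rhs : List (ℕ × Row) → ℕ → ℕ
  | [], _ => 0
  | (a, R) :: L, c => Nat.add (Nat.mul a (bit R.N c)) (rhs L c)

/-- The constant, in units of `n`, on the right side of a combination of inequalities. -/
def const : List (ℕ × Row) → ℕ
  | [] => 0
  | (a, R) :: L => Nat.add (Nat.mul a R.r) (const L)

/-- Whether `p` holds for all numbers below `n`. -/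
def allBelow : ℕ → (ℕ → Bool) → Bool
  | 0, _ => true
  | n + 1, p => p n && allBelow n p

/-- The label of colour `i` in a code. -/
def digit (c i : ℕ) : ℕ := c / (match i with | 0 => 16 | 1 => 4 | _ => 1) % 4

/-- A symmetry `g` permutes the colours, by the first three digits of `g` in base `4`, and then
exchanges the labels `T` and `U` in the colours given by the bits of the fourth digit. -/
def symColour (g i : ℕ) : ℕ := g / 4 ^ i % 4

/-- The action of a symmetry on a label, in colour `i`. -/
def symLabel (g i a : ℕ) : ℕ :=
  if Nat.beq (bit (g / 64) i) 1 then (if Nat.beq a 1 then 2 else if Nat.beq a 2 then 1 else a) else a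

/-- The action of a symmetry on codes. -/
def symCode (g c : ℕ) : ℕ :=
  code (symLabel g 0 (digit c (symColour g 0))) (symLabel g 1 (digit c (symColour g 1)))
    (symLabel g 2 (digit c (symColour g 2)))

/-- Whether a symmetry respects the types of the colours, the first `k` of which have a large
component. -/
def symValid (k g : ℕ) : Bool :=
  Nat.blt (symColour g 0) 3 && Nat.blt (symColour g 1) 3 && Nat.blt (symColour g 2) 3
  && !Nat.beq (symColour g 0) (symColour g 1) && !Nat.beq (symColour g 0) (symColour g 2)
  && !Nat.beq (symColour g 1) (symColour g 2)
  && allBelow 3 fun i => (Nat.blt (symColour g i) k == Nat.blt i k)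
    && (!Nat.blt i k || Nat.beq (bit (g / 64) i) 0)

/-- A case analysis.  A node `split q gs t₁ t₂` distinguishes whether the product set `q` occurs,
which is refuted by `t₁`, or not.  In the latter case the images `q'` of `q`, listed in `gs` with the
symmetries that take them to `q`, do not occur either, and `t₂` continues.  A leaf gives the
multipliers of a contradictory combination of inequalities. -/
inductive Tree
  | leaf (μ m : ℕ)
  | split (q : ℕ) (gs : List (ℕ × ℕ)) (t₁ t₂ : Tree)

/-- Whether a symmetry preserves the case in which the codes in `Z` do not occur and `4 * |M| ≤ n`
for the sets `M` in `C`, and takes `q'` to `q`. -/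
def symCheck (k Z : ℕ) (C : List ℕ) (q : ℕ) (g : ℕ × ℕ) : Bool :=
  symValid k g.1
  && allBelow 64 (fun c => Nat.ble (bit (prodMask g.2) c) (bit (prodMask q) (symCode g.1 c)))
  -- If a labelling avoids `Z`, so must its image. Likewise the vertices whose image code lies in
  -- `M` must have their own codes in some `M'` of `C`, so that the bound for `M` passes to the
  -- image. Codes in `Z` carry no vertices and are exempt.
  && allBelow 64 (fun c => Nat.beq (bit Z c) 1 || Nat.beq (bit Z (symCode g.1 c)) 0)
  && C.all fun M => C.any fun M' => allBelow 64 fun c =>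
      Nat.beq (bit Z c) 1 || Nat.ble (bit M (symCode g.1 c)) (bit M' c)

/-- The codes in the sets `q'` of a list of symmetries and sets. -/
def imagesMask : List (ℕ × ℕ) → ℕ
  | [] => 0
  | g :: gs => Nat.lor (prodMask g.2) (imagesMask gs)

/-- Checks a case analysis in the case in which the codes in `Z` do not occur and `4 * |M| ≤ n` for
the sets `M` in `C`. -/
def check (k : ℕ) : Tree → ℕ → List ℕ → Bool
  | .leaf μ m, Z, C =>
    Nat.blt 0 μ && Nat.ble (const (select (allRows k C) m)) (2 * μ)
    && allBelow 64 fun c => Nat.beq (bit Z c) 1 ||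
      Nat.ble (Nat.add μ (rhs (select (allRows k C) m) c)) (lhs (select (allRows k C) m) c)
  | .split q gs t₁ t₂, Z, C =>
    check k t₁ Z (prodMask (unrelProd k q) :: C) && gs.all (symCheck k Z C q)
    && check k t₂ (Nat.lor Z (Nat.lor (prodMask q) (imagesMask gs))) C

end ThreeColour

/-! ### Bit masks of label triples and soundness of the linear certificates -/

namespace ThreeColour

lemma bit_eq (m c : ℕ) : bit m c = (m.testBit c).toNat := by
  have : bit m c = m >>> c &&& 1 := rfl
  rw [this, Nat.and_one_is_mod, Nat.testBit_eq_decide_div_mod_eq, Nat.shiftRight_eq_div_pow]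
  rcases Nat.mod_two_eq_zero_or_one (m / 2 ^ c) with h | h <;> simp [h]

lemma bit_le_one (m c : ℕ) : bit m c ≤ 1 := by
  rw [bit_eq]; exact Bool.toNat_le _

lemma bit_land (m m' c : ℕ) : bit (Nat.land m m') c = bit m c * bit m' c := by
  have : Nat.land m m' = m &&& m' := rfl
  simp only [bit_eq, this, Nat.testBit_and]
  cases m.testBit c <;> cases m'.testBit c <;> rfl

lemma bit_lor_eq_zero {m m' c : ℕ} : bit (Nat.lor m m') c = 0 ↔ bit m c = 0 ∧ bit m' c = 0 := by
  have : Nat.lor m m' = m ||| m' := rfl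
  simp only [bit_eq, this, Nat.testBit_or]
  cases m.testBit c <;> cases m'.testBit c <;> simp

lemma allBelow_iff {n : ℕ} {p : ℕ → Bool} : allBelow n p = true ↔ ∀ c < n, p c = true := by
  induction n with
  | zero => simp [allBelow]
  | succ n ih =>
    simp only [allBelow, Bool.and_eq_true, ih]
    refine ⟨fun h c hc => ?_, fun h => ⟨h n n.lt_succ_self, fun c hc => h c (hc.trans n.lt_succ_self)⟩⟩
    rcases Nat.lt_succ_iff_lt_or_eq.mp hc with hc | rfl
    exacts [h.2 c hc, h.1]

lemma code_lt {a b c : ℕ} (ha : a < 4) (hb : b < 4) (hc : c < 4) : code a b c < 64 := by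
  unfold code; omega

/-- A label in the first, second or third colour has place value 16, 4 or 1 in a code. Its bit is
therefore stretched to a block of that length, and the pattern is repeated to fill 64 bits. -/
lemma bit_spread_first : ∀ x < 16, ∀ a < 4, ∀ b < 4, ∀ c < 4,
    bit (spread 0x10000 x) (code a b c) = bit x a := by
  decide +kernel

lemma bit_spread_second : ∀ x < 16, ∀ a < 4, ∀ b < 4, ∀ c < 4,
    bit (spread 0x10 x * 0x0001000100010001) (code a b c) = bit x b := by
  decide +kernel

lemma bit_spread_third : ∀ x < 16, ∀ a < 4, ∀ b < 4, ∀ c < 4,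
    bit (x * 0x1111111111111111) (code a b c) = bit x c := by
  decide +kernel

lemma bit_prodMask (q : ℕ) {a b c : ℕ} (ha : a < 4) (hb : b < 4) (hc : c < 4) :
    bit (prodMask q) (code a b c) =
      bit (q / 256 % 16) a * (bit (q / 16 % 16) b * bit (q % 16) c) := by
  rw [prodMask, bit_land, bit_land, bit_spread_first _ (Nat.mod_lt _ (by norm_num)) _ ha _ hb _ hc,
    bit_spread_second _ (Nat.mod_lt _ (by norm_num)) _ ha _ hb _ hc,
    bit_spread_third _ (Nat.mod_lt _ (by norm_num)) _ ha _ hb _ hc]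

lemma unrel_lt (big : Bool) {a : ℕ} (ha : a < 16) : unrel big a < 16 := by
  revert a; revert big; decide +kernel

lemma rel_eq_false_of_unrel : ∀ big : Bool, ∀ a < 16, ∀ l < 4, ∀ d < 4,
    bit a l = 1 → bit (unrel big a) d = 1 → rel big l d = false := by
  decide +kernel

lemma bit_pos_iff {m c : ℕ} : bit m c ≠ 0 ↔ bit m c = 1 := by
  have := bit_le_one m c; omega

variable {W : Type*}

/-- The code of the labels of a vertex. -/
def vcode (l : Fin 3 → W → ℕ) (v : W) : ℕ := code (l 0 v) (l 1 v) (l 2 v)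

lemma rel_eq_false_of_unrelProd {k q : ℕ} {l : Fin 3 → W → ℕ}
    (hl : ∀ i v, l i v < 4) {v w : W} (hv : bit (prodMask q) (vcode l v) ≠ 0)
    (hw : bit (prodMask (unrelProd k q)) (vcode l w) ≠ 0) (i : Fin 3) :
    rel (decide (i.val < k)) (l i v) (l i w) = false := by
  rw [vcode, bit_prodMask _ (hl _ _) (hl _ _) (hl _ _)] at hv hw
  have h0 := unrel_lt (Nat.blt 0 k) (a := q / 256 % 16) (by omega)
  have h1 := unrel_lt (Nat.blt 1 k) (a := q / 16 % 16) (by omega)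
  have h2 := unrel_lt (Nat.blt 2 k) (a := q % 16) (by omega)
  -- The three factors are below 16, so they are the hexadecimal digits of `unrelProd k q` without
  -- carries.
  have e0 : unrelProd k q / 256 % 16 = unrel (Nat.blt 0 k) (q / 256 % 16) := by unfold unrelProd; omega
  have e1 : unrelProd k q / 16 % 16 = unrel (Nat.blt 1 k) (q / 16 % 16) := by
    unfold unrelProd; omega
  have e2 : unrelProd k q % 16 = unrel (Nat.blt 2 k) (q % 16) := by unfold unrelProd; omega
  rw [e0, e1, e2] at hw
  simp only [ne_eq, mul_eq_zero, not_or] at hv hw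
  simp only [← ne_eq, bit_pos_iff] at hv hw
  have hb (j : ℕ) : Nat.blt j k = decide (j < k) := by
    rw [Bool.eq_iff_iff]; simp [Nat.blt_eq]
  rw [hb, hb, hb] at hw
  fin_cases i
  · exact rel_eq_false_of_unrel _ _ (by omega) _ (hl _ _) _ (hl _ _) hv.1 hw.1
  · exact rel_eq_false_of_unrel _ _ (by omega) _ (hl _ _) _ (hl _ _) hv.2.1 hw.2.1
  · exact rel_eq_false_of_unrel _ _ (by omega) _ (hl _ _) _ (hl _ _) hv.2.2 hw.2.2

variable [Fintype W]

/-- The number of vertices whose code is in a set. -/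
def size (l : Fin 3 → W → ℕ) (M : ℕ) : ℕ := ∑ v, bit M (vcode l v)

/-- A configuration satisfies a linear inequality. -/
def Row.Holds (R : Row) (n : ℕ) (l : Fin 3 → W → ℕ) : Prop :=
  R.w * size l R.A + size l R.B ≤ size l R.N + R.r * n

lemma size_zero (l : Fin 3 → W → ℕ) : size l 0 = 0 := by
  simp [size, bit_eq]

lemma bit_two_pow : ∀ a < 4, ∀ b < 4, bit (2 ^ a) b = if b = a then 1 else 0 := by decide +kernel

lemma bit_fifteen : ∀ b < 4, bit 15 b = 1 := by decide +kernel

lemma size_labelMask {l : Fin 3 → W → ℕ} (hl : ∀ i v, l i v < 4) (i : Fin 3) {a : ℕ} (ha : a < 4) :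
    size l (labelMask i a) = cnt (l i) a := by
  rw [size, cnt, Finset.card_filter]
  refine Finset.sum_congr rfl fun v _ => ?_
  rw [← bit_two_pow a ha _ (hl i v)]
  have hp : 2 ^ a ≤ 8 := by interval_cases a <;> norm_num
  have hp' : 0 < 2 ^ a := by positivity
  fin_cases i <;> simp only [labelMask, vcode]
  all_goals
    rw [bit_prodMask _ (hl _ _) (hl _ _) (hl _ _)]
  · rw [show (256 * 2 ^ a + 255) / 256 % 16 = 2 ^ a by omega,
      show (256 * 2 ^ a + 255) / 16 % 16 = 15 by omega,
      show (256 * 2 ^ a + 255) % 16 = 15 by omega, bit_fifteen _ (hl _ _), bit_fifteen _ (hl _ _)]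
    simp
  · rw [show (3840 + 16 * 2 ^ a + 15) / 256 % 16 = 15 by omega,
      show (3840 + 16 * 2 ^ a + 15) / 16 % 16 = 2 ^ a by omega,
      show (3840 + 16 * 2 ^ a + 15) % 16 = 15 by omega, bit_fifteen _ (hl _ _),
      bit_fifteen _ (hl _ _)]
    simp
  · rw [show (4080 + 2 ^ a) / 256 % 16 = 15 by omega,
      show (4080 + 2 ^ a) / 16 % 16 = 15 by omega,
      show (4080 + 2 ^ a) % 16 = 2 ^ a by omega, bit_fifteen _ (hl _ _),
      bit_fifteen _ (hl _ _)]
    simp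

lemma colourRows_holds {n k : ℕ} {l : Fin 3 → W → ℕ} (h : Config W n k l) (i : Fin 3) :
    ∀ R ∈ colourRows k i, R.Holds n l := by
  have h0 := size_labelMask h.lt i (a := 0) (by norm_num)
  have h1 := size_labelMask h.lt i (a := 1) (by norm_num)
  have h2 := size_labelMask h.lt i (a := 2) (by norm_num)
  have h3 := size_labelMask h.lt i (a := 3) (by norm_num)
  intro R hR
  have hle := h.le i
  by_cases hi : i.val < k
  · rw [colourRows, if_pos (by simpa [Nat.blt_eq] using hi)] at hR
    have := h.cover i hi
    simp only [List.mem_cons, List.not_mem_nil, or_false] at hR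
    rcases hR with rfl | rfl <;> simp only [Row.Holds, size_zero, h0, h2, h3] <;> omega
  · rw [colourRows, if_neg (by simpa [Nat.blt_eq] using hi)] at hR
    have h1' := h.le_one i hi
    have h2' := h.le_two i hi
    simp only [List.mem_cons, List.not_mem_nil, or_false] at hR
    rcases hR with rfl | rfl | rfl <;> simp only [Row.Holds, size_zero, h1, h2, h3] <;> omega

lemma allRows_holds {n k : ℕ} {l : Fin 3 → W → ℕ} (h : Config W n k l) {C : List ℕ}
    (hC : ∀ M ∈ C, 4 * size l M ≤ n) : ∀ R ∈ allRows k C, R.Holds n l := by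
  intro R hR
  simp only [allRows, List.mem_append, List.mem_map] at hR
  rcases hR with ⟨M, hM, rfl⟩ | hR | hR | hR
  · have := hC M hM
    simp only [Row.Holds, size_zero]; omega
  · exact colourRows_holds h 0 R hR
  · exact colourRows_holds h 1 R hR
  · exact colourRows_holds h 2 R hR

lemma mem_of_mem_select {L : List Row} {m : ℕ} {x : ℕ × Row} (hx : x ∈ select L m) : x.2 ∈ L := by
  induction L generalizing m with
  | nil => simp [select] at hx
  | cons R L ih =>
    rw [select] at hx
    cases hb : Nat.beq (Nat.mod m 128) 0 with
    | true => rw [hb, cond_true] at hx; exact List.mem_cons_of_mem _ (ih hx)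
    | false =>
      rw [hb, cond_false, List.mem_cons] at hx
      rcases hx with rfl | hx
      exacts [List.mem_cons_self, List.mem_cons_of_mem _ (ih hx)]

lemma sum_lhs_le {n : ℕ} {l : Fin 3 → W → ℕ} {L : List (ℕ × Row)}
    (hL : ∀ x ∈ L, x.2.Holds n l) :
    ∑ v, lhs L (vcode l v) ≤ ∑ v, rhs L (vcode l v) + const L * n := by
  induction L with
  | nil => simp [lhs, rhs, const]
  | cons x L ih =>
    obtain ⟨a, R⟩ := x
    have h1 := ih fun x hx => hL x (List.mem_cons_of_mem _ hx)
    have h2 := hL (a, R) List.mem_cons_self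
    have e1 (c : ℕ) : lhs ((a, R) :: L) c = a * (R.w * bit R.A c + bit R.B c) + lhs L c := rfl
    have e2 (c : ℕ) : rhs ((a, R) :: L) c = a * bit R.N c + rhs L c := rfl
    have e3 : const ((a, R) :: L) = a * R.r + const L := rfl
    simp only [e1, e2, e3, Finset.sum_add_distrib, ← Finset.mul_sum]
    have h3 := Nat.mul_le_mul_left a h2
    simp only [size] at h3
    nlinarith

/-- A Farkas certificate. Each occurring code has at least `μ` more on the left of the combined
inequality than on the right. Summing over the `2n + 1` vertices gives `μ(2n + 1) ≤ const L * n ≤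
2μn`. The one vertex beyond `2n` makes this absurd, so nonstrict inequalities suffice everywhere. -/
lemma leaf_false {n k μ : ℕ} {l : Fin 3 → W → ℕ} (h : Config W n k l) {Z : ℕ} {L : List (ℕ × Row)}
    (hZ : ∀ v, bit Z (vcode l v) = 0) (hL : ∀ x ∈ L, x.2.Holds n l) (hμ : 0 < μ)
    (hc : const L ≤ 2 * μ) (hcell : ∀ c < 64, bit Z c = 1 ∨ μ + rhs L c ≤ lhs L c) : False := by
  have h1 := sum_lhs_le hL
  have h2 : ∑ v, (μ + rhs L (vcode l v)) ≤ ∑ v, lhs L (vcode l v) := by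
    refine Finset.sum_le_sum fun v _ => (hcell _ (code_lt (h.lt _ _) (h.lt _ _) (h.lt _ _))).resolve_left ?_
    have := hZ v
    rw [vcode] at this
    omega
  rw [Finset.sum_add_distrib, Finset.sum_const, Finset.card_univ, h.card, smul_eq_mul] at h2
  have h3 := Nat.mul_le_mul_right n hc
  nlinarith

end ThreeColour

/-! ### Symmetries and soundness of the case analysis -/

namespace ThreeColour

variable {W : Type*}

lemma digit_code {l : Fin 3 → W → ℕ} (hl : ∀ i v, l i v < 4) (v : W) (i : Fin 3) :
    digit (vcode l v) i = l i v := by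
  have h0 := hl 0 v
  have h1 := hl 1 v
  have h2 := hl 2 v
  fin_cases i
  · change (16 * l 0 v + 4 * l 1 v + l 2 v) / 16 % 4 = l 0 v
    omega
  · change (16 * l 0 v + 4 * l 1 v + l 2 v) / 4 % 4 = l 1 v
    omega
  · change (16 * l 0 v + 4 * l 1 v + l 2 v) / 1 % 4 = l 2 v
    omega

/-- The image of a labelling under a symmetry. -/
def symApply (g : ℕ) (l : Fin 3 → W → ℕ) (i : Fin 3) (v : W) : ℕ :=
  symLabel g i (digit (vcode l v) (symColour g i))

lemma vcode_symApply (g : ℕ) (l : Fin 3 → W → ℕ) (v : W) :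
    vcode (symApply g l) v = symCode g (vcode l v) := rfl

variable [Fintype W]

lemma symLabel_of_ne {g i : ℕ} (h : bit (g / 64) i ≠ 1) (a : ℕ) : symLabel g i a = a := by
  rw [symLabel, if_neg (by simpa [Nat.beq_eq] using h)]

lemma symLabel_of_eq {g i : ℕ} (h : bit (g / 64) i = 1) (a : ℕ) :
    symLabel g i a = if a = 1 then 2 else if a = 2 then 1 else a := by
  rw [symLabel, if_pos (by simpa [Nat.beq_eq] using h)]
  simp [Nat.beq_eq]

/-- `T` and `U` are exchanged only in colours without a large component. There the relation is
equality of labels and the two bounds by `K` are interchangeable. Colours are permuted only among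
those of the same type. -/
lemma config_symApply {n k g : ℕ} {l : Fin 3 → W → ℕ} (h : Config W n k l)
    (hg : symValid k g = true) : Config W n k (symApply g l) := by
  simp only [symValid, Bool.and_eq_true, Nat.blt_eq, Bool.not_eq_true', allBelow_iff,
    beq_iff_eq, Bool.or_eq_true, Nat.beq_eq] at hg
  obtain ⟨⟨⟨⟨⟨⟨s0, s1⟩, s2⟩, d01⟩, d02⟩, d12⟩, hk⟩ := hg
  have hs (i : Fin 3) : symColour g i < 3 := by fin_cases i <;> assumption
  let σ (i : Fin 3) : Fin 3 := ⟨symColour g i, hs i⟩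
  have hσ : Function.Injective σ := by
    have ne {a b : ℕ} (h : Nat.beq a b = false) : a ≠ b := by
      rintro rfl; simp at h
    have := ne d01; have := ne d02; have := ne d12
    intro i j hij
    have hij : symColour g i = symColour g j := congrArg Fin.val hij
    fin_cases i <;> fin_cases j <;> simp_all
  have hσs : Function.Surjective σ := Finite.surjective_of_injective hσ
  have hkσ (i : Fin 3) : ((σ i).val < k ↔ i.val < k) ∧
      (i.val < k → bit (g / 64) i ≠ 1) := by
    obtain ⟨h1, h2⟩ := hk i i.2
    rw [Bool.eq_iff_iff] at h1
    simp only [Nat.blt_eq] at h1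
    refine ⟨h1, fun hi hb => ?_⟩
    rcases h2 with h2 | h2
    · have : Nat.blt i k = true := by simpa [Nat.blt_eq] using hi
      simp [this] at h2
    · omega
  have happ (i : Fin 3) (v : W) : symApply g l i v = symLabel g i (l (σ i) v) := by
    rw [symApply, ← digit_code h.lt v (σ i)]
  have hcnt (i : Fin 3) (a : ℕ) (hab : bit (g / 64) i ≠ 1) :
      cnt (symApply g l i) a = cnt (l (σ i)) a := by
    simp only [cnt, happ, symLabel_of_ne hab]
  have hcnt' (i : Fin 3) (a b : ℕ) (hi : bit (g / 64) i = 1)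
      (hab : ∀ x, (if x = 1 then 2 else if x = 2 then 1 else x) = a ↔ x = b) :
      cnt (symApply g l i) a = cnt (l (σ i)) b := by
    simp only [cnt, happ, symLabel_of_eq hi, hab]
  refine ⟨h.card, fun i v => ?_, fun i hi => ?_, fun i => ?_, fun i hi v => ?_, fun i hi => ?_,
    fun i hi => ?_, fun v => ?_⟩
  · rw [happ]
    have := h.lt (σ i) v
    by_cases hb : bit (g / 64) i = 1
    · rw [symLabel_of_eq hb]; split_ifs <;> omega
    · rwa [symLabel_of_ne hb]
  · rw [hcnt i 0 ((hkσ i).2 hi), hcnt i 2 ((hkσ i).2 hi)]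
    exact h.cover (σ i) ((hkσ i).1.2 hi)
  · by_cases hb : bit (g / 64) i = 1
    · rw [hcnt' i 3 3 hb (fun x => by split_ifs <;> omega)]; exact h.le _
    · rw [hcnt i 3 hb]; exact h.le _
  · rw [happ]
    have := h.ne_zero (σ i) (fun hc => hi ((hkσ i).1.1 hc)) v
    by_cases hb : bit (g / 64) i = 1
    · rw [symLabel_of_eq hb]; split_ifs <;> omega
    · rwa [symLabel_of_ne hb]
  · have hi' : ¬ (σ i).val < k := fun hc => hi ((hkσ i).1.1 hc)
    by_cases hb : bit (g / 64) i = 1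
    · rw [hcnt' i 3 3 hb (fun x => by split_ifs <;> omega),
        hcnt' i 1 2 hb (fun x => by split_ifs <;> omega)]
      exact h.le_two _ hi'
    · rw [hcnt i 3 hb, hcnt i 1 hb]; exact h.le_one _ hi'
  · have hi' : ¬ (σ i).val < k := fun hc => hi ((hkσ i).1.1 hc)
    by_cases hb : bit (g / 64) i = 1
    · rw [hcnt' i 3 3 hb (fun x => by split_ifs <;> omega),
        hcnt' i 2 1 hb (fun x => by split_ifs <;> omega)]
      exact h.le_one _ hi'
    · rw [hcnt i 3 hb, hcnt i 2 hb]; exact h.le_two _ hi'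
  -- The colour permutation is onto and the exchange of labels is injective, so vertices unrelated
  -- to `v` after the symmetry were unrelated to it before.
  · refine le_trans (Nat.mul_le_mul_left 4 (Finset.card_le_card fun w hw => ?_)) (h.missing v)
    simp only [Finset.mem_filter, Finset.mem_univ, true_and] at hw ⊢
    intro j
    obtain ⟨i, rfl⟩ := hσs j
    have hw := hw i
    rw [happ, happ] at hw
    by_cases hb : bit (g / 64) i = 1
    · have hi : ¬ i.val < k := fun hc => (hkσ i).2 hc hb
      have hi' : ¬ (σ i).val < k := fun hc => hi ((hkσ i).1.1 hc)
      rw [symLabel_of_eq hb, symLabel_of_eq hb] at hw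
      simp only [rel, hi, hi', decide_false, Bool.false_eq_true, if_false,
        decide_eq_false_iff_not] at hw ⊢
      intro he
      rw [he] at hw
      exact hw rfl
    · rw [symLabel_of_ne hb, symLabel_of_ne hb] at hw
      simpa only [(hkσ i).1] using hw

lemma mem_imagesMask {gs : List (ℕ × ℕ)} {c : ℕ} (h : ∀ g ∈ gs, bit (prodMask g.2) c = 0) :
    bit (imagesMask gs) c = 0 := by
  induction gs with
  | nil => simp [imagesMask, bit_eq]
  | cons g gs ih =>
    rw [imagesMask, bit_lor_eq_zero]
    exact ⟨h g List.mem_cons_self, ih fun g' hg' => h g' (List.mem_cons_of_mem _ hg')⟩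

lemma vcode_lt {n k : ℕ} {l : Fin 3 → W → ℕ} (h : Config W n k l) (v : W) : vcode l v < 64 :=
  code_lt (h.lt _ _) (h.lt _ _) (h.lt _ _)

/-- This is what an occurring product buys: one vertex `v` in it is unrelated, in all colours, to
everything counted here, whatever its exact labels are. -/
lemma size_unrelProd_le {n k q : ℕ} {l : Fin 3 → W → ℕ} (h : Config W n k l) {v : W}
    (hv : bit (prodMask q) (vcode l v) ≠ 0) : 4 * size l (prodMask (unrelProd k q)) ≤ n := by
  refine le_trans (Nat.mul_le_mul_left 4 ?_) (h.missing v)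
  rw [size, Finset.card_filter]
  refine Finset.sum_le_sum fun w _ => ?_
  split_ifs with hw
  · exact bit_le_one _ _
  · by_contra hc
    exact hw (rel_eq_false_of_unrelProd h.lt hv (by omega))

theorem false_of_check {n k : ℕ} (t : Tree) : ∀ {Z : ℕ} {C : List ℕ}, check k t Z C = true →
    ∀ {l : Fin 3 → W → ℕ}, Config W n k l → (∀ v, bit Z (vcode l v) = 0) →
      (∀ M ∈ C, 4 * size l M ≤ n) → False := by
  induction t with
  | leaf μ m =>
    intro Z C hc l h hZ hC
    simp only [check, Bool.and_eq_true, Nat.blt_eq, Nat.ble_eq, allBelow_iff, Bool.or_eq_true,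
      Nat.beq_eq] at hc
    exact leaf_false h hZ (fun x hx => allRows_holds h hC _ (mem_of_mem_select hx)) hc.1.1 hc.1.2
      hc.2
  | split q gs t₁ t₂ ih₁ ih₂ =>
    intro Z C hc l h hZ hC
    simp only [check, Bool.and_eq_true, List.all_eq_true] at hc
    obtain ⟨⟨hc₁, hgs⟩, hc₂⟩ := hc
    -- The labelling is kept general because the refutation by `t₁` is used again for images of `l`:
    -- a vertex of an image set `q'` would become a vertex of `q` under the symmetry.
    have key {l : Fin 3 → W → ℕ} (h : Config W n k l) (hZ : ∀ v, bit Z (vcode l v) = 0)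
        (hC : ∀ M ∈ C, 4 * size l M ≤ n) (v : W) : bit (prodMask q) (vcode l v) = 0 := by
      by_contra hv
      refine ih₁ hc₁ h hZ fun M hM => ?_
      rcases List.mem_cons.mp hM with rfl | hM
      exacts [size_unrelProd_le h hv, hC M hM]
    refine ih₂ hc₂ h (fun v => ?_) hC
    rw [bit_lor_eq_zero, bit_lor_eq_zero]
    refine ⟨hZ v, key h hZ hC v, mem_imagesMask fun g hg => ?_⟩
    have hs := hgs g hg
    simp only [symCheck, Bool.and_eq_true, allBelow_iff, Bool.or_eq_true, Nat.beq_eq, Nat.ble_eq,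
      List.all_eq_true, List.any_eq_true] at hs
    obtain ⟨⟨⟨hval, hq⟩, hZg⟩, hCg⟩ := hs
    have hnot (w : W) : ¬ bit Z (vcode l w) = 1 := by rw [hZ w]; norm_num
    have h0 := key (config_symApply h hval)
      (fun w => by rw [vcode_symApply]; exact (hZg _ (vcode_lt h w)).resolve_left (hnot w))
      (fun M hM => by
        obtain ⟨M', hM', hle⟩ := hCg M hM
        refine le_trans (Nat.mul_le_mul_left 4 (Finset.sum_le_sum fun w _ => ?_)) (hC M' hM')
        rw [vcode_symApply]
        exact (hle _ (vcode_lt h w)).resolve_left (hnot w)) v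
    rw [vcode_symApply] at h0
    have := hq _ (vcode_lt h v)
    omega

end ThreeColour

/-! ### From one labelling per colour to a configuration; grouping small components -/

namespace ThreeColour

variable {W : Type*} [Fintype W]

/-- The conditions on the labels in a single colour of a configuration. -/
structure Labelling (n : ℕ) (big : Bool) (f : W → ℕ) : Prop where
  lt : ∀ v, f v < 4
  cover : big = true → 2 * cnt f 0 + cnt f 2 ≤ n
  le : cnt f 3 ≤ n
  ne_zero : big = false → ∀ v, f v ≠ 0
  le_one : big = false → cnt f 1 ≤ cnt f 3
  le_two : big = false → cnt f 2 ≤ cnt f 3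

/-- Renumbering the colours leaves only four patterns of colour types, one for each tree. -/
lemma exists_perm_sorted : ∀ b : Fin 3 → Bool, ∃ k : Fin 4, ∃ σ : Equiv.Perm (Fin 3),
    ∀ i, b (σ i) = decide (i.val < k.val) := by
  decide +kernel

lemma exists_config {n : ℕ} (hW : Fintype.card W = 2 * n + 1) {b : Fin 3 → Bool}
    {f : Fin 3 → W → ℕ} (hf : ∀ i, Labelling n (b i) (f i))
    (hm : ∀ v, 4 * (Finset.univ.filter fun w => ∀ i, rel (b i) (f i v) (f i w) = false).card ≤ n) :
    ∃ k < 4, ∃ l : Fin 3 → W → ℕ, Config W n k l := by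
  obtain ⟨k, σ, hσ⟩ := exists_perm_sorted b
  refine ⟨k, k.2, fun i => f (σ i), hW, fun i => (hf _).lt,
    fun i hi => (hf _).cover (by simpa [hσ] using hi), fun i => (hf _).le,
    fun i hi => (hf _).ne_zero (by simpa [hσ] using hi),
    fun i hi => (hf _).le_one (by simpa [hσ] using hi),
    fun i hi => (hf _).le_two (by simpa [hσ] using hi), fun v => ?_⟩
  refine le_trans (Nat.mul_le_mul_left 4 (Finset.card_le_card fun w hw => ?_)) (hm v)
  simp only [Finset.mem_filter, Finset.mem_univ, true_and] at hw ⊢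
  intro j
  have := hw (σ.symm j)
  rw [← hσ, Equiv.apply_symm_apply] at this
  exact this

/-- A partition into small classes can be coarsened to one into three classes. -/
lemma exists_labelling_of_small {ι : Type*} [DecidableEq ι] {n : ℕ} (hW : Fintype.card W = 2 * n + 1) (c : W → ι)
    (hc : ∀ v, (Finset.univ.filter fun w => c w = c v).card ≤ n) :
    ∃ f : W → ℕ, Labelling n false f ∧ ∀ v w, c v = c w → f v = f w := by
  classical
  let J := Finset.univ.image c
  let sz (I : Finset ι) : ℕ := (Finset.univ.filter (c · ∈ I)).card
  have sz_union {I I' : Finset ι} (h : Disjoint I I') : sz (I ∪ I') = sz I + sz I' := by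
    simp only [sz, Finset.mem_union]
    rw [Finset.filter_or, Finset.card_union_of_disjoint]
    exact Finset.disjoint_filter.mpr fun v _ h1 h2 => Finset.disjoint_left.mp h h1 h2
  have sz_empty : sz ∅ = 0 := by simp [sz]
  have hmax (J' : Finset ι) : ∃ P ⊆ J', sz P ≤ n ∧ ∀ I ⊆ J', sz I ≤ n → sz I ≤ sz P := by
    obtain ⟨P, hP, hP'⟩ := Finset.exists_max_image (J'.powerset.filter (sz · ≤ n)) sz
      ⟨∅, by simp [sz_empty]⟩
    simp only [Finset.mem_filter, Finset.mem_powerset] at hP hP'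
    exact ⟨P, hP.1, hP.2, fun I h1 h2 => hP' I ⟨h1, h2⟩⟩
  -- Greedy choice: `P` is a largest union of classes with at most `n` vertices, `Q` is a largest
  -- one among the remaining classes, and `R` is the rest.
  obtain ⟨P, hPJ, hP, hPmax⟩ := hmax J
  obtain ⟨Q, hQJ, hQ, hQmax⟩ := hmax (J \ P)
  have hQP : Disjoint P Q := (Finset.subset_sdiff.mp hQJ).2.symm
  set R := J \ (P ∪ Q) with hR
  have hdR : Disjoint (P ∪ Q) R := Finset.disjoint_sdiff
  have htot : sz P + sz Q + sz R = 2 * n + 1 := by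
    rw [← sz_union hQP, ← sz_union hdR, hR, Finset.union_sdiff_of_subset
      (Finset.union_subset hPJ (hQJ.trans Finset.sdiff_subset)), ← hW]
    simp [sz, J]
  -- If `R` were larger, it would contain a class. By maximality that class is no larger than `Q`,
  -- and adding it to `P` exceeds `n`. Hence `P` and `Q` together exceed `n`, which leaves at most
  -- `n` for `R`.
  have hRn : sz R ≤ n := by
    by_contra! hlt
    obtain ⟨i, hi⟩ : R.Nonempty := by
      rw [Finset.nonempty_iff_ne_empty]; rintro h; rw [h, sz_empty] at hlt; omega
    have hiJ := (Finset.mem_sdiff.mp hi).1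
    have hiPQ := (Finset.mem_sdiff.mp hi).2
    rw [Finset.mem_union, not_or] at hiPQ
    obtain ⟨v, -, rfl⟩ := Finset.mem_image.mp hiJ
    have h1 : sz {c v} ≤ n := by simpa [sz] using hc v
    have h2 : 0 < sz {c v} := Finset.card_pos.mpr ⟨v, by simp⟩
    have h3 := hQmax {c v} (by simpa using ⟨hiJ, hiPQ.1⟩) h1
    have h4 := sz_union (I := P) (I' := {c v}) (by simpa using hiPQ.1)
    have h5 := hPmax (P ∪ {c v}) (Finset.union_subset hPJ (by simpa using hiJ))
    by_cases h6 : sz (P ∪ {c v}) ≤ n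
    · have := h5 h6; omega
    · omega
  let f (v : W) : ℕ := if c v ∈ P then 3 else if c v ∈ Q then 2 else 1
  have f3 : cnt f 3 = sz P := by
    refine congrArg _ (Finset.filter_congr fun v _ => ?_)
    simp only [f]; split_ifs <;> simp_all
  have f2 : cnt f 2 = sz Q := by
    refine congrArg _ (Finset.filter_congr fun v _ => ?_)
    have : c v ∈ P → c v ∉ Q := fun h1 h2 => Finset.disjoint_left.mp hQP h1 h2
    simp only [f]; split_ifs <;> simp_all
  have f1 : cnt f 1 = sz R := by
    refine congrArg _ (Finset.filter_congr fun v _ => ?_)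
    have : c v ∈ J := by simp [J]
    simp only [f, hR, Finset.mem_sdiff, this, Finset.mem_union, true_and, not_or]
    split_ifs <;> simp_all
  refine ⟨f, ⟨fun v => ?_, by simp, by rw [f3]; exact hP, fun _ v => ?_, fun _ => ?_, fun _ => ?_⟩,
    fun v w h => by simp only [f, h]⟩
  · simp only [f]; split_ifs <;> norm_num
  · simp only [f]; split_ifs <;> norm_num
  · rw [f1, f3]; exact hPmax R Finset.sdiff_subset hRn
  · rw [f2, f3]; exact hPmax Q (hQJ.trans Finset.sdiff_subset) hQ

end ThreeColour

/-! ### The Tutte–Berge formula, deduced from Tutte's theorem -/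

namespace SimpleGraph

variable {V : Type*}

/-- The graph obtained by adding `d` vertices adjacent to all other vertices. -/
def addUniversal (G : SimpleGraph V) (d : ℕ) : SimpleGraph (V ⊕ Fin d) where
  Adj x y := x ≠ y ∧ ∀ a b, x = Sum.inl a → y = Sum.inl b → G.Adj a b
  symm := ⟨fun _ _ h => ⟨h.1.symm, fun a b ha hb => (h.2 b a hb ha).symm⟩⟩
  loopless := ⟨fun _ h => h.1 rfl⟩

lemma addUniversal_adj_inl {G : SimpleGraph V} {d : ℕ} {a b : V} :
    (G.addUniversal d).Adj (Sum.inl a) (Sum.inl b) ↔ G.Adj a b :=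
  ⟨fun h => h.2 a b rfl rfl, fun h => ⟨by simpa using h.ne, by
    rintro _ _ ha hb; cases ha; cases hb; exact h⟩⟩

lemma addUniversal_adj_inr {G : SimpleGraph V} {d : ℕ} {i : Fin d} {x : V ⊕ Fin d}
    (hx : x ≠ Sum.inr i) : (G.addUniversal d).Adj (Sum.inr i) x :=
  ⟨hx.symm, by rintro _ _ ha; cases ha⟩

/-- A perfect matching after adding `d` universal vertices gives a matching that misses at most `d`
vertices. -/
lemma exists_isMatching_of_addUniversal [Fintype V] {G : SimpleGraph V} {d : ℕ}
    {P : (G.addUniversal d).Subgraph} (hP : P.IsPerfectMatching) :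
    ∃ M : G.Subgraph, M.IsMatching ∧ Fintype.card V ≤ M.verts.ncard + d := by
  let M : G.Subgraph :=
    { verts := {v | ∃ w, P.Adj (Sum.inl v) (Sum.inl w)}
      Adj := fun v w => P.Adj (Sum.inl v) (Sum.inl w)
      adj_sub := fun h => addUniversal_adj_inl.mp (P.adj_sub h)
      edge_vert := fun {v w} h => ⟨w, h⟩
      symm := ⟨fun _ _ h => P.adj_symm h⟩ }
  have hM : M.IsMatching := by
    rintro v ⟨w, hw⟩
    exact ⟨w, hw, fun w' hw' => Sum.inl_injective (hP.1.eq_of_adj_left hw' hw)⟩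
  refine ⟨M, hM, ?_⟩
  -- A vertex missed by `M` has its partner among the `d` added vertices, and different vertices
  -- have different partners.
  have hcompl : (M.vertsᶜ).ncard ≤ d := by
    have hex (v : V) (hv : v ∈ M.vertsᶜ) : ∃ i, P.Adj (Sum.inl v) (Sum.inr i) := by
      obtain ⟨y | i, hy⟩ := (hP.1 (hP.2 (Sum.inl v))).exists
      · exact absurd ⟨y, hy⟩ hv
      · exact ⟨i, hy⟩
    choose f hf using hex
    have hinj : Function.Injective fun v : (M.vertsᶜ : Set V) => f v v.2 := by
      rintro ⟨v, hv⟩ ⟨w, hw⟩ h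
      have h1 := hf v hv
      rw [show f v hv = f w hw from h] at h1
      exact Subtype.ext (Sum.inl_injective (hP.1.eq_of_adj_right h1 (hf w hw)))
    simpa using Nat.card_le_card_of_injective _ hinj
  have := Set.ncard_add_ncard_compl M.verts
  rw [Nat.card_eq_fintype_card] at this
  omega

open Classical in
/-- The number of odd components is at most the number of vertices in components of less than `L`
vertices plus the number of other components. -/
lemma ncard_oddComponents_le [Fintype V] (G : SimpleGraph V) {L : ℕ} (hL : 0 < L) :
    G.oddComponents.ncard ≤
      (Finset.univ.filter fun v => (G.connectedComponentMk v).supp.ncard < L).card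
        + Fintype.card V / L := by
  have hsupp (c : G.ConnectedComponent) :
      (Finset.univ.filter fun v => G.connectedComponentMk v = c).card = c.supp.ncard := by
    rw [Set.ncard_eq_toFinset_card']
    congr 1; ext v; simp
  set A : Finset G.ConnectedComponent := Finset.univ.filter fun c => c.supp.ncard < L with hA
  set B : Finset G.ConnectedComponent := Finset.univ.filter fun c => ¬ c.supp.ncard < L with hB
  have h1 : G.oddComponents.ncard ≤ A.card + B.card := by
    rw [hA, hB, Finset.card_filter_add_card_filter_not, Finset.card_univ,
      ← Nat.card_eq_fintype_card, ← Set.ncard_univ]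
    exact Set.ncard_le_ncard (Set.subset_univ _)
  -- Each small component is charged to one representative vertex. The large components are disjoint
  -- and have at least `L` vertices each, so there are at most `|V| / L` of them.
  have h2 : A.card ≤
      (Finset.univ.filter fun v => (G.connectedComponentMk v).supp.ncard < L).card := by
    refine Finset.card_le_card_of_injOn Quot.out (fun c hc => ?_) (fun c _ c' _ h => ?_)
    · have hc : c.supp.ncard < L := by simpa [hA] using hc
      have hout : G.connectedComponentMk (Quot.out c) = c := Quot.out_eq c
      rw [Finset.mem_coe, Finset.mem_filter, hout]
      exact ⟨Finset.mem_univ _, hc⟩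
    · rw [← Quot.out_eq c, ← Quot.out_eq c', h]
  have h3 : B.card ≤ Fintype.card V / L := by
    rw [Nat.le_div_iff_mul_le hL]
    calc B.card * L ≤ ∑ c ∈ B, (Finset.univ.filter fun v => G.connectedComponentMk v = c).card := by
          rw [← smul_eq_mul]
          refine Finset.card_nsmul_le_sum _ _ _ fun c hc => ?_
          rw [hsupp]
          simpa [hB] using hc
      _ ≤ ∑ c, (Finset.univ.filter fun v => G.connectedComponentMk v = c).card :=
          Finset.sum_le_sum_of_subset (Finset.subset_univ _)
      _ = Fintype.card V := by
          rw [← Finset.card_univ]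
          exact (Finset.card_eq_sum_card_fiberwise fun v _ => Finset.mem_univ _).symm
  omega

open Classical in
/-- A form of the Tutte–Berge formula in which the components of less than `L` vertices that
remain after the deletion of the set with label `0` have label `1`, and the others label `2`. -/
lemma exists_tutteBerge_labels [Fintype V] (G : SimpleGraph V) {n L : ℕ} (hn : Even n)
    (hnV : n ≤ Fintype.card V) (hL : 0 < L)
    (h : ∀ M : G.Subgraph, M.IsMatching → M.verts.ncard < n) :
    ∃ f : V → ℕ, (∀ v, f v < 3) ∧
      2 * ThreeColour.cnt f 0 + ThreeColour.cnt f 2 ≤ n + 2 * Fintype.card V / L ∧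
      (∀ v w, G.Adj v w → f v ≠ 0 → f w ≠ 0 → f v = f w) ∧
      ∀ v, f v = 1 → (Finset.univ.filter fun w => G.Adj v w ∧ f w = 1).card ≤ L := by
  -- With `|V| - n` added vertices, a perfect matching would leave a matching of `G` on at least `n`
  -- vertices. So there is none, and Tutte's theorem gives a violating set `u`.
  set d := Fintype.card V - n with hd
  set H := G.addUniversal d
  have hnp : ¬ ∃ P : H.Subgraph, P.IsPerfectMatching := by
    rintro ⟨P, hP⟩
    obtain ⟨M, hM, hc⟩ := exists_isMatching_of_addUniversal hP
    have := h M hM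
    omega
  rw [tutte] at hnp
  push Not at hnp
  obtain ⟨u, hu⟩ := hnp
  rw [IsTutteViolator] at hu
  set K := ((⊤ : H.Subgraph).deleteVerts u).coe with hK
  have hmem (x : V ⊕ Fin d) : x ∈ ((⊤ : H.Subgraph).deleteVerts u).verts ↔ x ∉ u := by simp
  have hKadj (x y : ((⊤ : H.Subgraph).deleteVerts u).verts) : K.Adj x y ↔ H.Adj x y := by
    have hx := (hmem x).1 x.2
    have hy := (hmem y).1 y.2
    simp [hK, hx, hy]
  have hcard : Nat.card ((⊤ : H.Subgraph).deleteVerts u).verts + u.ncard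
      = Fintype.card V + d := by
    have h1 := Set.ncard_add_ncard_compl u
    have h2 : ((⊤ : H.Subgraph).deleteVerts u).verts = uᶜ := by ext x; simp
    rw [Nat.card_coe_set_eq, h2, add_comm, h1]
    simp
  -- If an added vertex survived, the rest would be connected with at most one odd component. Then
  -- `u` would be empty and the number of vertices odd, but `2|V| - n` is even.
  have hinr (i : Fin d) : Sum.inr i ∈ u := by
    by_contra hi
    let z : ((⊤ : H.Subgraph).deleteVerts u).verts := ⟨Sum.inr i, (hmem _).2 hi⟩
    have hconn (c : K.ConnectedComponent) : c = K.connectedComponentMk z := by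
      induction c using ConnectedComponent.ind with
      | h x =>
        by_cases hx : x = z
        · rw [hx]
        · refine ConnectedComponent.eq.2 (Adj.reachable ?_).symm
          rw [hKadj]
          exact addUniversal_adj_inr fun h => hx (Subtype.ext h)
    have hle : K.oddComponents.ncard ≤ 1 :=
      (Set.ncard_le_one).2 fun a _ b _ => (hconn a).trans (hconn b).symm
    have hodd : K.oddComponents.ncard = 1 := by omega
    have h1 := (odd_ncard_oddComponents (G := K)).1 (by rw [hodd]; exact odd_one)
    have h2 : u.ncard = 0 := by omega
    obtain ⟨a, ha⟩ := hn
    obtain ⟨b, hb⟩ := h1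
    omega
  have hS : u.ncard = (Finset.univ.filter fun v : V => Sum.inl v ∈ u).card + d := by
    have : u = Set.range (Sum.inr : Fin d → V ⊕ Fin d) ∪ Sum.inl '' {v : V | Sum.inl v ∈ u} := by
      ext (x | x) <;> simp [hinr]
    rw [this, Set.ncard_union_eq]
    · rw [Set.ncard_image_of_injective _ Sum.inl_injective, ← Set.image_univ,
        Set.ncard_image_of_injective _ Sum.inr_injective, Set.ncard_univ]
      rw [Set.ncard_eq_toFinset_card']
      simp [add_comm]
    · rw [Set.disjoint_left]
      rintro _ ⟨i, rfl⟩ ⟨v, -, hv⟩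
      cases hv
  have hodd := ncard_oddComponents_le K hL
  let cs (v : V) (hv : Sum.inl v ∉ u) : K.ConnectedComponent :=
    K.connectedComponentMk ⟨Sum.inl v, (hmem _).2 hv⟩
  let f (v : V) : ℕ := if hv : Sum.inl v ∈ u then 0 else if (cs v hv).supp.ncard < L then 1 else 2
  have f0 (v : V) : f v = 0 ↔ Sum.inl v ∈ u := by
    simp only [f]; split_ifs <;> simp_all
  have f1 (v : V) (hv : Sum.inl v ∉ u) : f v = 1 ↔ (cs v hv).supp.ncard < L := by
    simp only [f, hv, dite_false]; split_ifs <;> simp_all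
  have hlt (v : V) : f v < 3 := by
    simp only [f]; split_ifs <;> norm_num
  have hT : (Finset.univ.filter fun x => (K.connectedComponentMk x).supp.ncard < L).card
      ≤ ThreeColour.cnt f 1 := by
    have hex (x : ((⊤ : H.Subgraph).deleteVerts u).verts) : ∃ v, x.1 = Sum.inl v := by
      obtain ⟨x | i, hx⟩ := x
      · exact ⟨x, rfl⟩
      · exact absurd (hinr i) ((hmem _).1 hx)
    choose g hg using hex
    refine Finset.card_le_card_of_injOn g (fun x hx => ?_) (fun x _ y _ hxy => ?_)
    · have hx : (K.connectedComponentMk x).supp.ncard < L := by simpa using hx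
      have hxu : Sum.inl (g x) ∉ u := by rw [← hg]; exact (hmem _).1 x.2
      have : (⟨Sum.inl (g x), (hmem _).2 hxu⟩ : ((⊤ : H.Subgraph).deleteVerts u).verts) = x :=
        Subtype.ext (hg x).symm
      have h1 : f (g x) = 1 := by
        rw [f1 _ hxu]; simp only [cs, this]; exact hx
      simpa using h1
    · exact Subtype.ext (by rw [hg, hg, hxy])
  have htot : ThreeColour.cnt f 0 + ThreeColour.cnt f 1 + ThreeColour.cnt f 2 = Fintype.card V := by
    rw [← Finset.card_univ, Finset.card_eq_sum_card_fiberwise (f := f) (t := Finset.range 3)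
      (fun v _ => by simpa using hlt v)]
    simp [Finset.sum_range_succ, ThreeColour.cnt]
  have hc0 : (Finset.univ.filter fun v : V => Sum.inl v ∈ u).card = ThreeColour.cnt f 0 := by
    simp only [ThreeColour.cnt, f0]
  have hX : Fintype.card ((⊤ : H.Subgraph).deleteVerts u).verts / L ≤ 2 * Fintype.card V / L := by
    rw [Nat.card_eq_fintype_card] at hcard
    exact Nat.div_le_div_right (by omega)
  -- The violation reads `|S| + |V| - n < |T| + 2|V| / L`. Substituting `|T| = |V| - |S| - |U|`
  -- gives the bound. Counting vertices of `T` in place of odd components loses nothing here, since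
  -- the edges inside `T` are few at each vertex.
  refine ⟨f, hlt, by omega, fun v w hvw hv hw => ?_, fun v hv => ?_⟩
  · rw [ne_eq, f0] at hv hw
    have : cs v hv = cs w hw := by
      refine ConnectedComponent.eq.2 (Adj.reachable ?_)
      rw [hKadj]
      exact addUniversal_adj_inl.2 hvw
    simp only [f, hv, hw, dite_false, this]
  · have hvu : Sum.inl v ∉ u := fun h => by rw [(f0 v).2 h] at hv; cases hv
    refine le_trans ?_ ((f1 v hvu).1 hv).le
    rw [← Set.ncard_coe_finset]
    -- The neighbours with label `1` lie in the component of `v`, which has fewer than `L` vertices.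
    -- They are not in `u`, so the default value is never taken on them.
    refine Set.ncard_le_ncard_of_injOn (fun w => if hw : Sum.inl w ∉ u then
      (⟨Sum.inl w, (hmem _).2 hw⟩ : ((⊤ : H.Subgraph).deleteVerts u).verts)
      else ⟨Sum.inl v, (hmem _).2 hvu⟩) ?_ ?_ (Set.toFinite _)
    · intro w hw
      have hw : G.Adj v w ∧ f w = 1 := by simpa using hw
      have hwu : Sum.inl w ∉ u := fun h => by rw [(f0 w).2 h] at hw; cases hw.2
      simp only [hwu, not_false_eq_true, dite_true, ConnectedComponent.mem_supp_iff]
      refine ConnectedComponent.eq.2 (Adj.reachable ?_)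
      rw [hKadj]
      exact addUniversal_adj_inl.2 hw.1.symm
    · intro w hw w' hw' hww
      have hw : G.Adj v w ∧ f w = 1 := by simpa using hw
      have hwu : Sum.inl w ∉ u := fun h => by rw [(f0 w).2 h] at hw; cases hw.2
      have hw' : G.Adj v w' ∧ f w' = 1 := by simpa using hw'
      have hwu' : Sum.inl w' ∉ u := fun h => by rw [(f0 w').2 h] at hw'; cases hw'.2
      simp only [hwu, hwu', not_false_eq_true, dite_true, Subtype.mk.injEq] at hww
      exact Sum.inl_injective hww

end SimpleGraph

/-! ### The case analyses -/

namespace ThreeColour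

/-- The case analysis for configurations in which no colour has a large component. -/
def treeZero : Tree :=
  -- A hexadecimal digit is a set of labels with `S, T, U, K` as bits 1, 2, 4, 8. The root asks for
  -- a vertex outside `K` in every colour, and if there is one, the next split asks for a vertex in
  -- `K` in every colour. The symmetry `0x21` exchanges the first two colours, and `0x64` exchanges
  -- `T` and `U` in the first.
  .split 0x666 [] (.split 0x888 [] (.split 0x688 [(0x21, 0x868), (0x12, 0x886)] (.split 0x866 []
  (.split 0x868 [(0x18, 0x886)] (.split 0x686 [] (.split 0x886 [] (.leaf 4 0x8000800204001)
  (.leaf 4 0x4000000000000010200080)) (.split 0x886 [] (.leaf 4 0x100010004001) (.leaf 4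
  0x80000000000000204000))) (.leaf 4 0x102000600180)) (.split 0x868 [(0x18, 0x886)] (.split 0x686
  [] (.split 0x886 [] (.leaf 4 0x20000000010000081) (.leaf 4 0x80000000000000200080)) (.split
  0x886 [] (.leaf 8 0x80000400002000400001) (.leaf 4 0x1000000000000004000))) (.leaf 4
  0x204000c000))) (.split 0x448 [(0x64, 0x248), (0xa4, 0x428), (0xe4, 0x228), (0x18, 0x484),
  (0x58, 0x284), (0x98, 0x482), (0xd8, 0x282), (0x9, 0x844), (0x49, 0x824), (0x89, 0x842), (0xc9,
  0x822)] (.split 0x268 [(0x21, 0x628)] (.split 0x628 [] (.leaf 8 0x102000810006000c183) (.leaf 4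
  0x20000000000404102)) (.leaf 8 0x102000c00006000030003)) (.leaf 4 0x81))) (.split 0x688 [(0x21,
  0x868), (0x12, 0x886)] (.split 0x866 [] (.split 0x868 [(0x18, 0x886)] (.split 0x686 [] (.split
  0x886 [] (.split 0x668 [] (.split 0x244 [(0x64, 0x444), (0xa4, 0x224), (0xe4, 0x424), (0x124,
  0x242), (0x164, 0x442), (0x1a4, 0x222), (0x1e4, 0x422)] (.split 0x884 [(0x18, 0x848), (0x149,
  0x288)] (.split 0x842 [(0xe1, 0x282)] (.leaf 8 0x1000008000000000001000c1000404104) (.leaf 4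
  0x2000000000000000000080020000082)) (.leaf 12 0x408002040010200000c003000c006)) (.leaf 4
  0x810204081)) (.leaf 4 0x10200000000000000000600180)) (.leaf 4 0x102000000000000c180)) (.split
  0x886 [] (.split 0x668 [] (.leaf 4 0x81000000000000600003) (.split 0x882 [(0x124, 0x884),
  (0x18, 0x828), (0x118, 0x848)] (.split 0x884 [] (.leaf 4 0x8000010000081) (.leaf 20
  0x600102000000600001800003)) (.leaf 4 0x8100000600000))) (.leaf 4 0x20400000000000180))) (.leaf
  4 0x2040000180)) (.split 0x868 [(0x18, 0x886)] (.split 0x686 [] (.split 0x886 [] (.split 0x668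
  [] (.leaf 4 0x40800000000c003) (.split 0x288 [(0x64, 0x488), (0x6, 0x882), (0x46, 0x884)]
  (.split 0x488 [] (.leaf 4 0x1000000000000200081) (.leaf 20 0x204000000c0018000000030003))
  (.leaf 4 0x204000000000000000000180))) (.leaf 4 0x102000000003)) (.split 0x886 [] (.split 0x668
  [] (.split 0x288 [(0x64, 0x488), (0x21, 0x828), (0x61, 0x848)] (.split 0x488 [] (.leaf 4
  0x200000000000000000004081) (.leaf 20 0x18102000018000000000603)) (.leaf 4
  0x204000000000000000000180)) (.split 0x288 [(0x64, 0x488), (0x21, 0x828), (0x61, 0x848), (0x12,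
  0x882), (0x52, 0x884)] (.split 0x488 [] (.leaf 4 0x2000010000080000000081) (.split 0x422
  [(0xa4, 0x442), (0x124, 0x424), (0x1a4, 0x444)] (.leaf 4 0x200001000000100000000083) (.leaf 1
  0x41000000000))) (.leaf 1 0x8100000000000000))) (.leaf 2 0x18102000810000000))) (.leaf 1
  0x10200000))) (.split 0x448 [(0x64, 0x248), (0xa4, 0x428), (0xe4, 0x228), (0x18, 0x484), (0x58,
  0x284), (0x98, 0x482), (0xd8, 0x282), (0x9, 0x844), (0x49, 0x824), (0x89, 0x842), (0xc9,
  0x822)] (.split 0x228 [] (.leaf 8 0x408002040000183) (.leaf 4 0x10200180000c0000003)) (.leaf 1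
  0x40800000000)))) (.split 0x688 [(0x21, 0x868), (0x12, 0x886)] (.split 0x866 [] (.split 0x868
  [(0x18, 0x886)] (.split 0x686 [] (.split 0x886 [] (.leaf 4 0x2000204001) (.leaf 4
  0x1000000000000200080)) (.leaf 1 0x8000000000200000)) (.leaf 8 0x600003020400180)) (.leaf 1
  0x2000010000000)) (.split 0x822 [(0xa4, 0x842), (0x124, 0x824), (0x1a4, 0x844), (0x21, 0x282),
  (0xa1, 0x482), (0x121, 0x284), (0x1a1, 0x484), (0x12, 0x228), (0x92, 0x428), (0x112, 0x248),
  (0x192, 0x448)] (.split 0x282 [(0x64, 0x482), (0x18, 0x228), (0x58, 0x428)] (.split 0x684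
  [(0x21, 0x864)] (.split 0x486 [] (.leaf 4 0x8000000004081) (.leaf 6 0x10000080040c00081))
  (.leaf 1 0x8200000000000000)) (.leaf 4 0x201)) (.leaf 1 0x1)))

/-- The case analysis for configurations in which one colour has a large component. -/
def treeOne : Tree :=
  .split 0x766 [] (.split 0x888 [] (.split 0x788 [] (.split 0x866 [] (.split 0x868 [(0x18,
  0x886)] (.split 0x786 [] (.split 0x886 [] (.leaf 4 0x400000800204001) (.leaf 4
  0x80000000000010200080)) (.split 0x886 [] (.leaf 4 0x8000010004001) (.leaf 4
  0x1000000000000204000))) (.split 0x268 [(0x18, 0x286)] (.split 0x684 [(0x124, 0x682)] (.split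
  0x28a [] (.leaf 12 0x8000020008001020008081) (.leaf 8 0x80000000100820400101)) (.leaf 4
  0x1000000001000204000)) (.leaf 4 0x10000080020004080))) (.split 0x868 [(0x18, 0x886)] (.split
  0x786 [] (.split 0x886 [] (.leaf 4 0x400000010000081) (.leaf 4 0x1000000000000200080)) (.split
  0x886 [] (.leaf 8 0x1000008100000400001) (.leaf 4 0x20000000000004000))) (.split 0x282 [(0x124,
  0x284), (0x18, 0x228), (0x118, 0x248)] (.leaf 4 0x100020004001) (.leaf 4 0x200001000400080))))
  (.split 0x868 [(0x18, 0x886)] (.split 0x786 [] (.split 0x886 [] (.leaf 4 0x100000204001) (.leaf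
  4 0x408000000600180)) (.split 0x886 [] (.leaf 4 0x2000004001) (.leaf 4 0x810000000c000)))
  (.split 0x648 [(0xa4, 0x628), (0x18, 0x684), (0x98, 0x682)] (.split 0xec6 [] (.split 0x684
  [(0x124, 0x682)] (.split 0x6aa [] (.leaf 4 0x100800200081) (.leaf 8 0x4001020008002020004001))
  (.leaf 4 0x400000040400081)) (.leaf 8 0x800000000800082)) (.leaf 4 0x1020008100000c180))))
  (.split 0x788 [] (.split 0x866 [] (.split 0x868 [(0x18, 0x886)] (.split 0x786 [] (.split 0x886
  [] (.split 0x768 [] (.split 0x882 [(0x124, 0x884), (0x18, 0x828), (0x118, 0x848)] (.split 0x884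
  [] (.leaf 16 0x4080000000000000618186000c183) (.leaf 4 0x10000000000000041010400002)) (.leaf 4
  0x10200000000000000030000180)) (.leaf 4 0x204000000000000000600180)) (.leaf 4
  0x2040000000000c180)) (.split 0x886 [] (.split 0x768 [] (.leaf 4 0x1020000000000600003) (.split
  0x882 [(0x124, 0x884), (0x18, 0x828), (0x118, 0x848)] (.split 0x884 [] (.leaf 4
  0x400000010000081) (.leaf 20 0xc002040030000001800003)) (.leaf 4 0x2040000000000c000))) (.leaf
  4 0x408000000000180))) (.split 0x648 [(0xa4, 0x628), (0x18, 0x684), (0x98, 0x682)] (.split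
  0x228 [] (.split 0xe22 [(0x124, 0xe24)] (.leaf 8 0x80020000180000204101) (.leaf 4
  0x1000000001000000001)) (.split 0x248 [] (.leaf 2 0x10000001000004001) (.split 0x6a8 [] (.leaf
  4 0x2000004081) (.leaf 10 0x810006000000c0000003)))) (.leaf 4 0x810004080000600003))) (.split
  0x868 [(0x18, 0x886)] (.split 0x786 [] (.split 0x886 [] (.split 0x768 [] (.split 0x6cc [(0xa4,
  0x6ac), (0x124, 0x6ca), (0x1a4, 0x6aa)] (.split 0x288 [] (.split 0x268 [(0x18, 0x286)] (.leaf 4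
  0x10000000010000000000000081) (.leaf 8 0x200001000400000010004002)) (.split 0xeca [(0x18,
  0xeac)] (.split 0xe8a [(0x124, 0xe8c)] (.split 0xe8c [] (.split 0x282 [(0x124, 0x284)] (.leaf
  12 0x2000000400100000100000800000104) (.split 0xc82 [(0x124, 0xc84)] (.leaf 4
  0x80000002000800000081) (.leaf 16 0x1810200003000000000000000183))) (.split 0xa82 [] (.leaf 4
  0x40800000000800000040000000001) (.leaf 8 0x4080000600000c0000000000))) (.leaf 2
  0x2040000300000000000000)) (.leaf 4 0x80000008000000000001))) (.leaf 4 0x80000004001)) (.split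
  0x688 [] (.split 0x288 [] (.leaf 8 0x40008000000400081) (.split 0x224 [(0xa4, 0x244), (0x124,
  0x222), (0x1a4, 0x242)] (.leaf 20 0x20400000060018000001200183) (.leaf 8
  0x10200000060018000000c000))) (.split 0xa82 [(0x124, 0xa84)] (.split 0xa84 [] (.leaf 16
  0x1020000006000c000000c00183) (.leaf 4 0x4000000000100000008001)) (.leaf 8
  0x4080000600000c000)))) (.split 0x688 [] (.split 0x288 [] (.leaf 8 0x100000000100000400081)
  (.split 0x222 [(0xa4, 0x242), (0x124, 0x224), (0x1a4, 0x244)] (.leaf 20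
  0x182040000300001200183) (.leaf 8 0x181020000300000c000))) (.split 0x282 [(0x124, 0x284)]
  (.leaf 4 0x80000000002000004002) (.leaf 8 0x8100000c0000180)))) (.split 0x886 [] (.split 0x768
  [] (.split 0x688 [] (.split 0x288 [] (.leaf 8 0x8000000008000000008081) (.split 0x242 [(0xa4,
  0x222), (0x124, 0x244), (0x1a4, 0x224)] (.leaf 20 0xc102000018000000024183) (.leaf 8
  0xc0810000180000000180))) (.split 0xa28 [(0xa4, 0xa48)] (.split 0xa48 [] (.leaf 16
  0xc08100000c000000018183) (.leaf 4 0x20000100000000101)) (.leaf 8 0x4080020400006000000003)))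
  (.split 0xacc [(0xa4, 0xaac), (0x124, 0xaca), (0x1a4, 0xaaa)] (.split 0x666 [] (.split 0x288 []
  (.split 0x266 [] (.leaf 4 0x20200000000000081) (.leaf 8 0x2000010608000000000081)) (.split
  0x264 [(0x18, 0x246)] (.split 0xaac [] (.split 0x848 [(0xa4, 0x828)] (.split 0x828 [] (.leaf 4
  0x400002040000000000000000081) (.split 0x222 [] (.leaf 4 0x800000000000204081) (.split 0x726 []
  (.leaf 4 0x2000000000001000000000000204002) (.leaf 1 0x80040000000000000000000)))) (.leaf 4
  0x800000000000400000000200081)) (.leaf 4 0x80000008000000004002)) (.split 0x222 [] (.split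
  0x424 [(0x18, 0x442)] (.leaf 24 0x10000180081400000000400284) (.leaf 8 0x808000000008001))
  (.leaf 1 0x2040000000000)))) (.leaf 2 0x400002040800000000)) (.leaf 1 0x10000000))) (.split
  0x688 [] (.split 0x288 [] (.leaf 4 0x1000000001000000001) (.leaf 16 0x604080000c0000003))
  (.leaf 2 0x4080000600000)))) (.split 0x68c [(0x124, 0x68a), (0x18, 0x6c8), (0x118, 0x6a8)]
  (.split 0x6c8 [(0xa4, 0x6a8)] (.split 0x288 [] (.split 0x268 [(0x18, 0x286)] (.leaf 4
  0x80000000080000000081) (.leaf 4 0x800004001000000001)) (.split 0x268 [(0x18, 0x286)] (.split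
  0x246 [] (.leaf 4 0x1000000100000004101) (.split 0x226 [] (.leaf 4 0x20000100000000101) (.leaf
  8 0x1810200003000000003))) (.split 0x488 [] (.leaf 4 0x2000000001) (.leaf 2
  0x20400102000030000000)))) (.leaf 2 0x810000000000600000)) (.leaf 2 0x8100000c000)))) (.split
  0x868 [(0x18, 0x886)] (.split 0x786 [] (.split 0x886 [] (.leaf 4 0x81000000000000000183) (.leaf
  4 0x8100000000180)) (.split 0x886 [] (.leaf 8 0x10200081000c0000003) (.leaf 1 0x40800000000)))
  (.split 0x284 [(0x124, 0x282), (0x18, 0x248), (0x118, 0x228)] (.split 0x282 [] (.leaf 16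
  0x1020000006001800183) (.leaf 2 0x10000000000008001)) (.leaf 2 0x102000810000180))))) (.split
  0x788 [] (.split 0x866 [] (.split 0x868 [(0x18, 0x886)] (.split 0x786 [] (.split 0x886 []
  (.leaf 4 0x100000204001) (.leaf 4 0x20000000000200080)) (.leaf 1 0x100000010000000)) (.split
  0x282 [(0x124, 0x284), (0x18, 0x228), (0x118, 0x248)] (.leaf 4 0x2000404001) (.leaf 4
  0x4000020008080))) (.leaf 1 0x40000200000)) (.split 0x868 [(0x18, 0x886)] (.split 0x786 []
  (.split 0x886 [] (.leaf 4 0x40004001) (.leaf 8 0xc081000c00180)) (.leaf 1 0x40000004000))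
  (.split 0x228 [(0xa4, 0x248), (0x18, 0x282), (0x98, 0x284)] (.split 0x748 [] (.leaf 4
  0x8000000008081) (.split 0x842 [(0x124, 0x844)] (.leaf 8 0x400000041000003) (.leaf 1
  0x10400000))) (.leaf 1 0x81))))

/-- The case analysis for configurations in which two colours have a large component. -/
def treeTwo : Tree :=
  .split 0x776 [] (.split 0x888 [] (.split 0x788 [(0x21, 0x878)] (.split 0x876 [] (.split 0x878
  [] (.split 0x786 [] (.split 0x886 [] (.leaf 4 0x1000000000810000081) (.leaf 4
  0x1000000000010200080)) (.split 0x886 [] (.leaf 4 0x8000010004001) (.leaf 4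
  0x20000000000204000))) (.split 0x886 [] (.leaf 4 0x400000000204001) (.split 0x682 [(0x124,
  0x684)] (.split 0x678 [] (.split 0x278 [] (.split 0x286 [] (.leaf 16 0x8100000400102000204081)
  (.leaf 12 0x101000008001830004001)) (.split 0x286 [] (.leaf 12 0x82000008001830000081) (.leaf 4
  0x810000080010200000))) (.leaf 4 0x400001000204000)) (.leaf 4 0x400000020004080)))) (.split
  0x878 [] (.split 0x786 [] (.split 0x886 [] (.leaf 4 0x20000000010000081) (.leaf 4
  0x20000000000200080)) (.split 0x886 [] (.leaf 8 0x20400100000400001) (.leaf 4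
  0x400000000004000))) (.split 0x886 [] (.leaf 4 0x8000000004001) (.split 0x278 [] (.leaf 4
  0x400000020004001) (.split 0x282 [(0x124, 0x284)] (.leaf 8 0x10000040008001) (.leaf 4
  0x4080000400080)))))) (.split 0x886 [] (.leaf 4 0x2040000000000c003) (.split 0xea6 [(0x21,
  0xae6)] (.split 0x628 [] (.split 0x268 [] (.leaf 8 0x20008002010004081) (.leaf 4
  0x80040200001)) (.split 0x822 [(0x124, 0x824)] (.split 0x824 [] (.leaf 4 0x4100000000081)
  (.leaf 2 0x10000080000200001)) (.split 0x6a4 [(0x124, 0x6a2)] (.split 0x282 [] (.split 0x284 []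
  (.leaf 4 0x20000080000000081) (.leaf 2 0x800000001010000001)) (.split 0x284 [] (.leaf 2
  0x40000000001010000001) (.split 0x482 [] (.leaf 28 0x8100001800c090600183) (.leaf 8
  0x1000400100040404001)))) (.leaf 4 0x2000404000)))) (.leaf 2 0x80010004000)))) (.split 0x788
  [(0x21, 0x878)] (.split 0x876 [] (.split 0x878 [] (.split 0x786 [] (.split 0x886 [] (.split
  0x778 [] (.split 0xee2 [(0x124, 0xee4)] (.split 0x222 [] (.leaf 4 0x10000040010000040010200001)
  (.split 0x282 [(0x21, 0x822)] (.split 0x28c [] (.leaf 4 0x800002040000200081) (.leaf 4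
  0x10000000020000040000004002)) (.split 0x228 [] (.leaf 4 0x40010000040010200001) (.split 0x288
  [(0x21, 0x828)] (.leaf 4 0x10000040810204001) (.split 0x248 [(0x21, 0x428)] (.leaf 8
  0x100020000040000200002) (.split 0x824 [(0x21, 0x284)] (.leaf 4 0x800000080000000000010004002)
  (.split 0x488 [(0x21, 0x848)] (.leaf 4 0x20000000010204001) (.leaf 16
  0x10200003000c00000000000183)))))))) (.leaf 4 0x10004000010004080)) (.leaf 4
  0x4080000000000000600180)) (.split 0x6a2 [(0x124, 0x6a4), (0x21, 0xa62), (0x121, 0xa64)]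
  (.split 0xa62 [] (.split 0x2ac [(0x21, 0xa2c)] (.leaf 4 0x800200000010004081) (.split 0x6e8
  [(0x21, 0xe68)] (.leaf 8 0x204001000400000010004081) (.leaf 1 0x1000008002000000000000)))
  (.split 0x288 [] (.leaf 8 0x80010008000010400081) (.leaf 4 0x200100000004001))) (.leaf 2
  0x10002000800000000))) (.split 0x886 [] (.split 0x778 [] (.split 0xee2 [(0x124, 0xee4)] (.split
  0xeec [] (.split 0x828 [] (.split 0x866 [] (.split 0x826 [] (.leaf 4
  0x104000000000000000004001) (.leaf 8 0x10004080000000000010000101)) (.leaf 4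
  0x200040000000000000200001)) (.split 0x848 [] (.split 0x228 [] (.leaf 16
  0x20008001000004000800200104) (.split 0x822 [(0x124, 0x824)] (.leaf 12
  0x800008100000100000010000104) (.leaf 4 0x80000000040010200001))) (.split 0x2e8 [] (.split
  0x6a8 [] (.leaf 8 0x4001000004000820200081) (.leaf 16 0x8100001800300000c0030600003)) (.split
  0x264 [(0x124, 0x262)] (.split 0x262 [] (.leaf 16 0x4080000c003000000000000000183) (.leaf 8
  0x800200080020002000000204001)) (.leaf 4 0x800400040000004000))))) (.leaf 1
  0x1000008002000000000000)) (.leaf 2 0x800100040000000000)) (.split 0x868 [] (.split 0x764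
  [(0x124, 0x762)] (.split 0x762 [] (.leaf 4 0x1000000000800004081) (.leaf 8
  0x200080020400000020000081)) (.leaf 4 0x208000000200000)) (.split 0x264 [(0x124, 0x262)] (.leaf
  4 0x4000000400080000200001) (.split 0x424 [(0x124, 0x422)] (.split 0x422 [] (.leaf 4
  0x10008000000000081) (.leaf 8 0x4000000408100000400001)) (.leaf 8 0x4080000618180000c000)))))
  (.split 0x622 [(0x124, 0x624)] (.split 0x262 [] (.split 0xeec [] (.leaf 8
  0x4080020008000800004081) (.leaf 1 0x20000100040000000000)) (.leaf 4 0x4002000200001)) (.split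
  0x244 [(0x124, 0x242)] (.leaf 4 0x8001000200001) (.split 0x862 [(0x124, 0x864)] (.split 0x566
  [] (.leaf 8 0x1000400100020000081) (.leaf 8 0x20008100000200001)) (.leaf 2
  0x200040010000000)))))) (.split 0x886 [] (.leaf 4 0x1020000000000000183) (.split 0x222 [(0x124,
  0x224)] (.split 0x62c [] (.leaf 6 0x800008002000000101) (.split 0xeec [] (.split 0x282 []
  (.leaf 4 0x81000000080000004001) (.leaf 8 0x1020008002000200101)) (.leaf 1
  0x8000040010000000))) (.split 0x6e6 [] (.split 0x282 [(0x124, 0x284)] (.split 0x28c [] (.leaf 4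
  0x20000080000000081) (.leaf 4 0x1000000002000004002)) (.split 0x6ac [(0x124, 0x6aa)] (.split
  0x2a8 [] (.split 0x268 [] (.leaf 8 0x80020008000010200081) (.leaf 4 0x200100000200001)) (.split
  0x826 [] (.leaf 16 0x4080000c00300030000003) (.leaf 1 0x2000800000000))) (.leaf 4
  0x100020004000))) (.split 0x862 [(0x124, 0x864)] (.leaf 8 0x400100040008001) (.leaf 2
  0x4000800200000)))))) (.split 0x878 [] (.split 0x786 [] (.split 0x886 [] (.split 0x778 []
  (.split 0xeac [(0x124, 0xeaa)] (.split 0xeaa [] (.split 0x674 [(0x124, 0x672)] (.split 0xa84 []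
  (.split 0xe8a [] (.split 0x67a [] (.split 0x6e6 [] (.split 0xa8a [] (.leaf 8
  0x2000010000000800000000820204001) (.leaf 4 0x200000008000000000204080)) (.leaf 8
  0x40008004000000100080000204080)) (.leaf 8 0x2000810000080000004000000004001)) (.leaf 4
  0x40010000000800000040000000001)) (.split 0xa68 [] (.split 0x266 [] (.leaf 8
  0x200080000002040810204081) (.split 0x688 [] (.leaf 4 0x80000002040000004001) (.leaf 8
  0x4001000000081010000081))) (.split 0x264 [] (.leaf 12 0x40000008002000000000000208102) (.leaf
  4 0x40020000000000004001)))) (.leaf 4 0x80000200000010200000)) (.split 0xa4a [] (.leaf 4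
  0x1000200000000004001) (.leaf 1 0x80000008002000000000000))) (.leaf 2 0x200040000000000))
  (.split 0x288 [] (.leaf 4 0x20000080000004001) (.split 0x222 [(0x124, 0x224)] (.leaf 4
  0x80000200100000004001) (.split 0x254 [(0x124, 0x252)] (.split 0xa84 [] (.leaf 4
  0x200000000008000000400081) (.split 0x244 [] (.leaf 16 0x204000060018000000600003) (.leaf 14
  0x2100000600300000018003))) (.leaf 8 0x40800600003000000180))))) (.split 0x622 [(0x124, 0x624)]
  (.split 0x262 [] (.split 0xeec [] (.leaf 8 0x4080020008000010004081) (.leaf 1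
  0x20000100040000000000)) (.leaf 4 0x4002000004001)) (.split 0x246 [] (.leaf 4 0x8001000004001)
  (.split 0x682 [(0x124, 0x684)] (.split 0x288 [] (.leaf 8 0x1020000100000200082) (.leaf 8
  0x20008002000008001)) (.leaf 2 0x200040010000000))))) (.split 0x886 [] (.split 0x778 [] (.split
  0x6ec [(0x124, 0x6ea), (0x21, 0xe6c)] (.split 0xeea [] (.split 0x264 [(0x124, 0x262), (0x21,
  0x624), (0x121, 0x622)] (.split 0x624 [] (.leaf 8 0x800200080020000000010004081) (.leaf 4
  0x1000200000000200001)) (.split 0x288 [(0x21, 0x828)] (.leaf 4 0x4000000200000000200001) (.leaf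
  8 0x80020008000000208000))) (.leaf 1 0x1000000100040000000000)) (.leaf 4 0x4001000000001))
  (.split 0x6ec [(0x124, 0x6ea), (0x21, 0xe6c)] (.split 0x288 [(0x21, 0x828)] (.split 0x676 []
  (.split 0x276 [] (.leaf 8 0x40400000000008081) (.leaf 8 0x40800608000000000081)) (.leaf 2
  0x408002040000000000)) (.split 0xeea [] (.split 0x264 [(0x124, 0x262), (0x21, 0x624), (0x121,
  0x622)] (.split 0x262 [] (.leaf 4 0x1000200000000000081) (.split 0x224 [] (.leaf 7
  0xc000041010400000000004001) (.split 0x526 [] (.leaf 8 0x10002041010400000000000081) (.leaf 1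
  0x408000000000000000)))) (.leaf 2 0x8102040000000000)) (.leaf 1 0x20000002000800000000)))
  (.leaf 7 0x4080060c1830000000))) (.split 0x262 [(0x124, 0x264), (0x21, 0x622), (0x121, 0x624)]
  (.split 0x622 [] (.split 0x6ec [(0x21, 0xe6c)] (.leaf 6 0x40000400100000004081) (.leaf 1
  0x400002000800000000)) (.leaf 4 0x100020000001)) (.leaf 2 0x4000800200000)))) (.split 0x886 []
  (.split 0x778 [] (.split 0x6ac [(0x124, 0x6aa)] (.split 0xeaa [] (.split 0x288 [] (.leaf 4
  0x1000004000010000001) (.split 0x276 [] (.split 0x268 [] (.leaf 8 0x1000400001000204082)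
  (.split 0x264 [(0x124, 0x262)] (.leaf 8 0x10000081000400000800204001) (.leaf 20
  0x408003030018000060000003))) (.leaf 8 0x2040030000180000600000))) (.leaf 8
  0x10000000800400000c001)) (.leaf 4 0x100020000001)) (.split 0x688 [] (.split 0x288 [] (.leaf 8
  0x800002000000081) (.leaf 16 0x10200180000c0000003)) (.leaf 2 0x10200000000600000))) (.split
  0x6e2 [(0x124, 0x6e4)] (.split 0x6ec [] (.split 0x248 [] (.split 0x266 [] (.leaf 4
  0x400080000000081) (.split 0x288 [] (.leaf 4 0x1000000080000000081) (.leaf 8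
  0x20008002000004002))) (.split 0x288 [] (.split 0x286 [] (.leaf 4 0x20000080000000081) (.split
  0x486 [] (.leaf 8 0x1020000100000000101) (.leaf 4 0x20000001000000001))) (.split 0x628 []
  (.leaf 4 0x4002000004001) (.split 0x262 [(0x124, 0x264)] (.split 0x282 [] (.leaf 4
  0x80000000100000000082) (.leaf 16 0x81000018006000000183)) (.split 0x658 [] (.leaf 4
  0x4002000000001) (.leaf 8 0x81000c0c0060000000)))))) (.leaf 1 0x100000800200000)) (.leaf 2
  0x80010004000))))) (.split 0x886 [] (.leaf 4 0x408000000000003) (.split 0x2ec [(0x124, 0x2ea),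
  (0x21, 0xe2c), (0x121, 0xe2a)] (.split 0x628 [] (.split 0x268 [] (.split 0xee6 [] (.leaf 8
  0x20008002000004081) (.leaf 2 0x200040010000000)) (.leaf 4 0x1000800001)) (.split 0x248 []
  (.leaf 4 0x2000400001) (.split 0xae2 [] (.split 0x824 [] (.leaf 4 0x1000000100000004002)
  (.split 0x658 [] (.split 0x224 [] (.leaf 12 0x80000010004000408101) (.leaf 16
  0x10200003000c000c003)) (.leaf 2 0x10200000000600000))) (.leaf 1 0x100000010004000)))) (.leaf 4
  0x2040000600180))))) (.split 0x788 [(0x21, 0x878)] (.split 0x876 [] (.split 0x878 [] (.split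
  0x786 [] (.split 0x886 [] (.leaf 4 0x400000010000081) (.leaf 4 0x400000000200080)) (.leaf 1
  0x2000010000000)) (.split 0x886 [] (.leaf 4 0x100000004001) (.split 0x278 [] (.leaf 4
  0x8000000404001) (.split 0x286 [] (.leaf 8 0x200000808001) (.leaf 4 0x81000008080))))) (.leaf 1
  0x810000000)) (.split 0x886 [] (.leaf 8 0x4080060018003) (.split 0xee6 [] (.split 0x682
  [(0x124, 0x684), (0x21, 0x862), (0x121, 0x864)] (.split 0x284 [] (.leaf 4 0x100000400081)
  (.split 0x584 [] (.split 0x282 [] (.leaf 4 0x8000020000081) (.leaf 6 0x4080020800081)) (.split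
  0xe7c [] (.split 0x768 [] (.split 0x874 [] (.split 0x866 [] (.leaf 8 0x1000408000000004101)
  (.leaf 4 0x20004000000000001)) (.leaf 1 0x8200000000000000)) (.split 0x824 [] (.leaf 4
  0x82000000001) (.leaf 3 0x100081020000000))) (.leaf 3 0x2001000408000)))) (.leaf 10
  0x3020808201)) (.leaf 2 0x20004001))))

/-- The case analysis for configurations in which all colours have a large component. -/
def treeThree : Tree :=
  .split 0x777 [] (.split 0x888 [] (.split 0x788 [(0x21, 0x878), (0x12, 0x887)] (.split 0x877 []
  (.split 0x878 [(0x18, 0x887)] (.split 0x787 [] (.split 0x887 [] (.leaf 4 0x1000000000810000081)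
  (.leaf 4 0x80000000000010200080)) (.split 0x887 [] (.leaf 4 0x8000010004001) (.leaf 4
  0x1000000000000204000))) (.split 0x6a6 [(0x18, 0x66a)] (.split 0xe7e [] (.split 0x687 []
  (.split 0x287 [] (.split 0x228 [] (.leaf 16 0x20008080020004080000004082) (.split 0x222 []
  (.leaf 4 0x100040010000000000000001) (.split 0x258 [] (.leaf 16 0x20008000020008100000004082)
  (.split 0x478 [] (.leaf 12 0x100080000200060c0000000081) (.leaf 4 0x80000200040800000000)))))
  (.split 0x278 [] (.leaf 12 0x4000800004000c1800000081) (.leaf 4 0x2000800004000810000000)))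
  (.leaf 4 0x80000000080010200000)) (.leaf 2 0x8200000800000000)) (.split 0x826 [(0x18, 0x862)]
  (.leaf 12 0x102040800101020c001) (.leaf 8 0x20208080020004080)))) (.split 0x878 [(0x18, 0x887)]
  (.split 0x787 [] (.split 0x887 [] (.leaf 4 0x20000000010000081) (.leaf 4
  0x1000000000000200080)) (.split 0x887 [] (.leaf 8 0x1000400100000400001) (.leaf 4
  0x20000000000004000))) (.split 0x287 [(0x18, 0x278)] (.leaf 4 0x8000020004001) (.leaf 4
  0x200080000400080)))) (.split 0x268 [(0x18, 0x286), (0x21, 0x628), (0x12, 0x682), (0x9, 0x826),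
  (0x6, 0x862)] (.split 0x628 [] (.split 0x226 [] (.leaf 8 0x8002000004082) (.split 0x6e7 [(0x21,
  0xe67)] (.leaf 8 0x1000008002010004081) (.leaf 2 0x10000040010000000))) (.leaf 4 0x2000404001))
  (.leaf 4 0x80020008081))) (.split 0x788 [(0x21, 0x878), (0x12, 0x887)] (.split 0x877 [] (.split
  0x878 [(0x18, 0x887)] (.split 0x787 [] (.split 0x887 [] (.split 0x778 [] (.split 0x6aa [(0x21,
  0xa6a), (0x12, 0xaa6)] (.split 0xaee [] (.split 0xa28 [(0x18, 0xa82)] (.split 0x86a [] (.split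
  0x68a [] (.split 0x822 [] (.leaf 4 0x1000400000000000100040000000081) (.split 0x228 [] (.leaf 4
  0x400100000400102000000000001) (.split 0x282 [] (.leaf 4 0x1000000100000400000040000200001)
  (.split 0x882 [] (.leaf 4 0x1000000000000400100040000004081) (.split 0x288 [] (.leaf 4
  0x100000400102040000200001) (.split 0x668 [] (.leaf 24 0x20010004000410006080c0000408102)
  (.leaf 12 0x40010004000410006041000004081))))))) (.split 0x668 [] (.leaf 8
  0x10004000400004080800004001) (.leaf 4 0x100040008000040010000080))) (.split 0x668 [] (.leaf 8
  0x200080008200001010000081) (.leaf 4 0x2000800102000000200001))) (.split 0xa48 [(0x18, 0xa84)]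
  (.split 0x822 [] (.leaf 8 0x800200000000000040010400002) (.split 0x884 [] (.split 0x848 []
  (.split 0x288 [] (.leaf 16 0x20008002000010003040c0800004182) (.leaf 12
  0x40010004000410004041010000082)) (.leaf 12 0x800200080008302040820200081)) (.split 0x222 []
  (.leaf 4 0x400100040000000000000000001) (.split 0x288 [] (.leaf 4 0x40000100040810000081)
  (.split 0x668 [] (.leaf 8 0x400200080000100040800200081) (.leaf 8
  0x10004001000002000800004001)))))) (.split 0xa26 [(0x18, 0xa62)] (.leaf 4
  0x8002000800000000000004001) (.split 0x288 [] (.leaf 8 0x8002001000004040810200001) (.leaf 2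
  0x80020010000000000000000))))) (.leaf 2 0x1000400200000000000000)) (.leaf 2
  0x20008002000000000000)) (.split 0x266 [(0x21, 0x626)] (.split 0x242 [] (.split 0xeae []
  (.split 0x3a6 [] (.leaf 8 0x10004001000000000000204081) (.leaf 8 0x200100000000080000004080))
  (.leaf 2 0x1000800100000000000000)) (.split 0xeea [] (.split 0x8ee [] (.split 0x442 [] (.leaf 8
  0x10004001000100000800200001) (.split 0x842 [] (.leaf 8 0x10004080800000000000200001) (.split
  0x612 [] (.split 0x868 [] (.leaf 8 0x800200040008100040010000081) (.leaf 8
  0x10004001000100000000204001)) (.split 0x386 [] (.leaf 4 0x10000000800000000000200001) (.split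
  0x122 [] (.leaf 8 0x10004001000000000000404001) (.split 0x572 [] (.leaf 12
  0x20004001000102001000404001) (.leaf 4 0x200000000002040010004000))))))) (.leaf 8
  0x4001000400000010000101)) (.leaf 2 0x40008002000000000000))) (.split 0x288 [(0x21, 0x828)]
  (.leaf 4 0x1000004000000004001) (.split 0x776 [] (.split 0x652 [(0x21, 0x562)] (.split 0x682 []
  (.leaf 4 0x100000020000000000000081) (.split 0x822 [] (.leaf 8 0x200080000004000010004082)
  (.split 0x882 [] (.leaf 8 0x200000000004081020004082) (.leaf 8 0x4001000400040800200001))))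
  (.split 0x682 [(0x21, 0x862)] (.leaf 8 0x4080000400000010000082) (.leaf 16
  0x10202000800101000c002))) (.leaf 4 0x820000000010000080))))) (.split 0x266 [(0x21, 0x626)]
  (.split 0x2a6 [] (.split 0x6ca [] (.split 0x288 [] (.leaf 8 0x80020000041000204002) (.leaf 8
  0x4001000400000010004081)) (.split 0xe6a [] (.leaf 8 0x4001000400040000000101) (.leaf 2
  0x40008002000000000000))) (.split 0xeae [] (.split 0x268 [] (.leaf 4 0x1000200000000004001)
  (.split 0x288 [] (.leaf 8 0x1000400000820204002) (.leaf 8 0x80020008000800004081))) (.leaf 2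
  0x400200040000000000))) (.split 0xa67 [(0x21, 0x6a7)] (.split 0xea7 [] (.split 0x822 [] (.leaf
  4 0x2000800000040000200001) (.split 0x282 [] (.leaf 4 0x2000000200000810000001) (.split 0x288
  [] (.leaf 4 0x200000000200000010000001) (.split 0x828 [] (.leaf 4 0x200000800000040000000001)
  (.split 0x2a5 [] (.leaf 8 0x4001000400040010004001) (.leaf 16 0x80040010001800408102))))))
  (.leaf 4 0x400080000000081)) (.leaf 2 0x800002000800000000)))) (.split 0x887 [] (.split 0x778
  [] (.split 0x222 [] (.leaf 4 0x40010004000000000001) (.split 0x266 [(0x6, 0x662)] (.split 0x624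
  [] (.split 0xeea [] (.split 0x76a [] (.leaf 8 0x10004001000000000000204081) (.leaf 8
  0x400080000000080000004080)) (.leaf 2 0x2000400100000000000000)) (.split 0x8a6 [] (.split 0x868
  [] (.split 0x327 [] (.leaf 8 0x10004000800102000010204001) (.split 0x866 [] (.leaf 8
  0x10004080000000000000204002) (.leaf 8 0x10200080000000040000204080))) (.leaf 8
  0x4001000200040800004081)) (.split 0x228 [] (.leaf 8 0x200001000400000000000082) (.split 0x288
  [] (.leaf 4 0x200000000200000000004001) (.split 0x828 [] (.leaf 8 0x2001020200000800200081)
  (.split 0x422 [] (.leaf 8 0x4001000400000000000081) (.split 0x4a8 [] (.leaf 8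
  0x202001000400000000004001) (.leaf 2 0x20010002000000000000)))))))) (.split 0x288 [(0x6,
  0x882)] (.leaf 4 0x4000000004000000000081) (.split 0x767 [] (.split 0x526 [(0x6, 0x625)]
  (.split 0x826 [] (.leaf 4 0x200040000000000000000081) (.split 0x828 [] (.leaf 8
  0x80000004080020404082) (.split 0x228 [] (.leaf 8 0x80020000040020000082) (.leaf 8
  0x4001000400000800204001)))) (.split 0x628 [(0x6, 0x826)] (.leaf 8 0x200001000400000000200082)
  (.leaf 16 0x80040808000030008082))) (.leaf 4 0x208000000200080))))) (.split 0x226 [(0x18,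
  0x262)] (.split 0x222 [] (.leaf 4 0x40010004000000000001) (.split 0xeea [] (.split 0x162 []
  (.leaf 8 0x4001000400000800004081) (.leaf 4 0x80010000000010000080)) (.leaf 2
  0x800100040000000000))) (.split 0x422 [] (.split 0xaae [(0x18, 0xaea)] (.leaf 8
  0x80020008000010000101) (.leaf 2 0x400100080000000000)) (.split 0x828 [(0x18, 0x882)] (.leaf 4
  0x208000000200001) (.split 0x526 [(0x18, 0x562)] (.split 0x562 [] (.leaf 8
  0x80020008000020000081) (.leaf 4 0x1000200000000200001)) (.leaf 8 0x20008100000208000))))))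
  (.split 0x266 [] (.split 0x224 [] (.split 0xeea [] (.leaf 8 0x80020008000800004081) (.leaf 2
  0x800100040000000000)) (.split 0xeae [] (.split 0x2e8 [] (.leaf 4 0x20004000000004001) (.split
  0x727 [] (.leaf 8 0x80020008000800004081) (.leaf 4 0x400080010000080))) (.leaf 2
  0x8004000800000000))) (.split 0xae8 [] (.split 0xe67 [] (.split 0x828 [] (.leaf 4
  0x4000010000000800000001) (.split 0x6e8 [] (.split 0x6a8 [] (.leaf 8
  0x200001000400000000204081) (.leaf 8 0x40008000000004002)) (.leaf 8 0x800408100010000080)))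
  (.leaf 2 0x800002000800000000)) (.split 0x866 [] (.leaf 8 0x20008002000400001) (.leaf 2
  0x100040020000000)))))) (.split 0x222 [] (.leaf 4 0x200080020000001) (.split 0x26a [(0x18,
  0x2a6)] (.split 0x628 [] (.split 0x623 [] (.leaf 4 0x200100000000081) (.split 0xee7 [] (.split
  0x268 [] (.leaf 8 0x4000020008000010004081) (.leaf 4 0x200100000200080)) (.leaf 2
  0x800002000800000000))) (.split 0xeae [] (.split 0x248 [] (.leaf 4 0x400080000200001) (.split
  0x68a [] (.split 0x282 [] (.leaf 4 0x40000004000010200001) (.leaf 8 0x1000400100000404001))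
  (.leaf 8 0x20008002000200081))) (.leaf 2 0x100080010000000))) (.split 0x826 [(0x18, 0x862)]
  (.leaf 8 0x400100040008081) (.split 0x288 [] (.split 0x218 [(0x18, 0x281)] (.leaf 8
  0x1010004002000004081) (.leaf 4 0x40000081)) (.leaf 2 0x2000800400000)))))) (.split 0x878
  [(0x18, 0x887)] (.split 0x787 [] (.split 0x887 [] (.split 0x778 [] (.split 0x222 [] (.leaf 4
  0x40010004000000000001) (.split 0x224 [(0x18, 0x242)] (.split 0x228 [] (.leaf 4
  0x800200000000000081) (.split 0x282 [] (.leaf 8 0x4000000400000800004102) (.split 0xaa8 []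
  (.leaf 4 0x800200000800004081) (.split 0xc82 [] (.leaf 8 0x4000800400000810004081) (.split
  0xeea [] (.leaf 8 0x4001000400000800004081) (.leaf 2 0x40008002000000000000)))))) (.split 0xa8e
  [(0x18, 0xae8)] (.split 0xe8a [] (.split 0x882 [] (.leaf 4 0x104000000000000800000001) (.split
  0x828 [] (.leaf 4 0x10000040000000000000200001) (.split 0x288 [] (.split 0x687 [] (.split 0x287
  [] (.leaf 8 0x20000080000000000000008081) (.leaf 8 0x800200001000000000010000101)) (.leaf 4
  0x10000000010000000000200001)) (.split 0x67a [] (.split 0x277 [] (.split 0x682 [] (.leaf 8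
  0x800000080000100040010004082) (.leaf 8 0x10000001000000081000204081)) (.leaf 4
  0x20000040810200000)) (.leaf 8 0x4080000400000820000001))))) (.split 0x2c4 [] (.split 0x284 []
  (.leaf 4 0x200000010000000000000001) (.leaf 8 0x4001000400000010204001)) (.leaf 8
  0x80010008000000408081))) (.leaf 2 0x400100080000000000)))) (.split 0x266 [(0x6, 0x662)]
  (.split 0x242 [] (.split 0x226 [] (.leaf 8 0x4001000400000000000081) (.split 0x282 [] (.leaf 4
  0x2000000200000000000081) (.split 0xa8a [] (.leaf 4 0x2000000200000010000081) (.split 0xeae []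
  (.leaf 8 0x4001000400000010000081) (.leaf 2 0x20010002000000000000))))) (.split 0xeea []
  (.split 0x652 [] (.leaf 8 0x4001000400000010004081) (.leaf 4 0x80000004000000200080)) (.leaf 2
  0x800100040000000000))) (.split 0x288 [(0x6, 0x882)] (.leaf 4 0x20000080000004001) (.split
  0x212 [] (.leaf 8 0x1000400100000208001) (.split 0x282 [] (.leaf 8 0x1020000100000200002)
  (.leaf 4 0x10202001000000080)))))) (.split 0x266 [] (.split 0x2a6 [] (.split 0xeea [] (.split
  0x288 [] (.leaf 8 0x1000400001000404002) (.leaf 8 0x80020008000010004081)) (.leaf 2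
  0x800100040000000000)) (.split 0x228 [] (.leaf 8 0x80000400100000000082) (.split 0xeaa []
  (.split 0x625 [] (.leaf 8 0x80020008000000004081) (.leaf 4 0x400080000200080)) (.leaf 2
  0x8004000800000000)))) (.split 0xae8 [] (.split 0x6e7 [] (.split 0x288 [] (.leaf 4
  0x4000000004000010000001) (.split 0x6a7 [] (.split 0x261 [] (.leaf 8 0x2001000400001000200081)
  (.leaf 4 0x10008000010000001)) (.leaf 8 0x80800400100000000001))) (.leaf 2
  0x800002000800000000)) (.split 0x286 [] (.leaf 8 0x20404002000004001) (.leaf 2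
  0x100040020000000))))) (.split 0x887 [] (.split 0x778 [] (.split 0x266 [(0x21, 0x626)] (.split
  0x224 [] (.split 0x22a [] (.leaf 8 0x4001000400000000000101) (.split 0xaaa [] (.leaf 8
  0x4001000400000000200101) (.split 0xeea [] (.leaf 8 0x4001000400000000200081) (.leaf 2
  0x40008002000000000000)))) (.split 0xeae [] (.split 0x625 [] (.leaf 8 0x4001000400000000204081)
  (.leaf 4 0x20004000000004080)) (.leaf 2 0x400200040000000000))) (.split 0x288 [(0x21, 0x828)]
  (.leaf 4 0x80000000080000000081) (.split 0x221 [] (.leaf 4 0x800200080000000081) (.split 0x228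
  [] (.leaf 8 0x80000400100000004081) (.leaf 4 0x808004001000000001))))) (.split 0x226 [(0x18,
  0x262), (0x9, 0x622)] (.split 0x222 [] (.leaf 8 0x1000400100000000081) (.split 0xaca [(0x21,
  0xcaa)] (.split 0x772 [] (.leaf 8 0x80020008000000008081) (.split 0x882 [] (.leaf 8
  0x6080800200000000004001) (.leaf 1 0x20400000000000000000))) (.leaf 2 0x10002000800000000)))
  (.split 0x882 [(0x18, 0x828), (0x9, 0x288)] (.split 0x576 [(0x21, 0x756)] (.split 0x572 [(0x21,
  0x752)] (.leaf 4 0x4040000000000000004001) (.leaf 8 0xc1010004000000000081)) (.leaf 2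
  0x408100040000000000)) (.split 0x772 [(0x18, 0x727), (0x9, 0x277)] (.split 0x488 [(0x21,
  0x848)] (.split 0x727 [] (.split 0x277 [] (.leaf 8 0x4001000400000000200081) (.leaf 1
  0x102000000000000)) (.leaf 1 0x8100000000000000)) (.leaf 8 0x20008002000000001)) (.leaf 1
  0x810000000))))) (.split 0x262 [(0x21, 0x622)] (.split 0x222 [] (.leaf 4 0x10004001000000001)
  (.split 0xea8 [] (.leaf 8 0x1010008002000000081) (.split 0x626 [] (.leaf 8 0x20008002000000081)
  (.leaf 2 0x100080010000000)))) (.split 0x6a8 [(0x21, 0xa68)] (.split 0x625 [] (.leaf 4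
  0x4002000000081) (.split 0x245 [] (.leaf 8 0x1000008002000000081) (.leaf 2
  0x10000040010000000))) (.leaf 2 0x4000800200000))))) (.split 0x222 [] (.leaf 4 0x4001000400001)
  (.split 0x26a [(0x18, 0x2a6)] (.split 0x246 [] (.split 0x6ae [] (.split 0x268 [] (.leaf 4
  0x400080000004001) (.leaf 8 0x20008002000004101)) (.leaf 2 0x100080010000000)) (.split 0x221 []
  (.leaf 4 0x200080020000081) (.split 0x6a7 [] (.split 0x288 [] (.split 0x287 [] (.leaf 4
  0x20000080000000081) (.split 0x238 [] (.leaf 8 0x100000000100000000101) (.leaf 8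
  0x1000400002000000082))) (.split 0x628 [] (.leaf 4 0x4002000000081) (.split 0x248 [] (.leaf 4
  0x808004001000000001) (.leaf 16 0x410200080000180)))) (.split 0x241 [] (.leaf 4 0x100020000001)
  (.leaf 2 0x200000800200000))))) (.split 0x288 [] (.split 0x218 [(0x18, 0x281)] (.leaf 4
  0x20000000020000081) (.leaf 4 0x200080000400001)) (.leaf 2 0x40010008000)))))) (.split 0x66a
  [(0x18, 0x6a6), (0x9, 0xa66)] (.split 0x22a [] (.split 0x6e7 [(0x21, 0xe67)] (.split 0x2a7
  [(0x21, 0xa27)] (.leaf 4 0x10004001000004001) (.leaf 8 0x20200100040000081)) (.leaf 2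
  0x200000800200000)) (.split 0xa66 [(0x21, 0x6a6)] (.split 0xeae [] (.split 0x248 [] (.leaf 8
  0x10002000004002) (.split 0x5ae [] (.leaf 8 0x20008002000204081) (.leaf 4 0x200100000004000)))
  (.leaf 2 0x2001000200000)) (.leaf 2 0x2040010004000))) (.leaf 2 0x800200080)))) (.split 0x788
  [(0x21, 0x878), (0x12, 0x887)] (.split 0x877 [] (.split 0x878 [(0x18, 0x887)] (.split 0x787 []
  (.split 0x887 [] (.leaf 4 0x400000010000081) (.leaf 4 0x20000000000200080)) (.leaf 1
  0x100000010000000)) (.split 0x287 [(0x18, 0x278)] (.leaf 4 0x100000404001) (.leaf 4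
  0x4001000008080))) (.leaf 1 0x40010000000)) (.split 0x268 [(0x18, 0x286), (0x21, 0x628), (0x12,
  0x682), (0x9, 0x826), (0x6, 0x862)] (.split 0x628 [] (.split 0xec7 [(0x21, 0xce7)] (.split
  0x867 [(0x21, 0x687)] (.split 0xea7 [] (.leaf 12 0x1000408102010200081) (.leaf 12
  0x40000102060004080)) (.leaf 10 0x600082020800001)) (.leaf 2 0x4000010004000)) (.split 0xea7 []
  (.split 0x287 [] (.leaf 4 0x40404001) (.leaf 10 0x4001040c10081)) (.leaf 2 0x40000204080)))
  (.leaf 3 0x810204081)))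

end ThreeColour

/-! ### Evaluation of the checker -/

namespace ThreeColour
/-- The codes that do not occur: the label `S` is not used in a colour without a large component. -/
def unusedMask (k : ℕ) : ℕ :=
  Nat.lor (if Nat.blt 0 k then 0 else labelMask 0 0)
    (Nat.lor (if Nat.blt 1 k then 0 else labelMask 1 0) (if Nat.blt 2 k then 0 else labelMask 2 0))

/-- The number `n` enters the inequalities only as a scale, so each of these four finite
computations excludes configurations of every size. -/
theorem check_treeZero : check 0 treeZero (unusedMask 0) [] = true := by decide +kernel
theorem check_treeOne : check 1 treeOne (unusedMask 1) [] = true := by decide +kernel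
theorem check_treeTwo : check 2 treeTwo (unusedMask 2) [] = true := by decide +kernel
theorem check_treeThree : check 3 treeThree (unusedMask 3) [] = true := by decide +kernel
end ThreeColour

/-! ### Trimming a matching to a prescribed size -/

namespace SimpleGraph

variable {V : Type*}

/-- A matching contains matchings with any smaller even number of vertices. -/
lemma Subgraph.IsMatching.exists_le_ncard_eq [Finite V] {G : SimpleGraph V} {n : ℕ} (hn : Even n) :
    ∀ (d : ℕ) {M : G.Subgraph}, M.IsMatching → M.verts.ncard = n + d →
      ∃ M' : G.Subgraph, M'.IsMatching ∧ M'.verts ⊆ M.verts ∧ M'.verts.ncard = n := by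
  classical
  cases nonempty_fintype V
  intro d
  induction d using Nat.strong_induction_on with
  | _ d ih =>
    intro M hM hd
    have hev : Even (n + d) := by
      rw [← hd, Set.ncard_eq_toFinset_card']; exact hM.even_card
    obtain rfl | hd0 := Nat.eq_zero_or_pos d
    · exact ⟨M, hM, subset_rfl, hd⟩
    -- The excess `d` is even because a matching saturates an even number of vertices, so a whole
    -- edge can be removed.
    have hd2 : 2 ≤ d := by
      have := (Nat.even_add.1 hev).1 hn
      obtain ⟨a, ha⟩ := this
      omega
    obtain ⟨v, hv⟩ : M.verts.Nonempty := (Set.ncard_pos (Set.toFinite _)).1 (by omega)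
    obtain ⟨w, hw, -⟩ := hM hv
    have hsub : ({v, w} : Set V) ⊆ M.verts := by
      rintro x (rfl | rfl)
      exacts [hv, M.edge_vert hw.symm]
    have hM' : (M.induce (M.verts \ {v, w})).IsMatching := by
      rintro x ⟨hx, hxvw⟩
      obtain ⟨y, hy, hyu⟩ := hM hx
      simp only [Set.mem_insert_iff, Set.mem_singleton_iff, not_or] at hxvw
      refine ⟨y, ⟨⟨hx, by simpa using hxvw⟩, ⟨M.edge_vert hy.symm, ?_⟩, hy⟩, fun z hz => hyu z hz.2.2⟩
      rintro (rfl | rfl)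
      · exact hxvw.2 (hM.eq_of_adj_left hw hy.symm).symm
      · exact hxvw.1 (hM.eq_of_adj_right hy hw)
    have hcard : (M.verts \ {v, w}).ncard = n + (d - 2) := by
      rw [Set.ncard_sdiff hsub (Set.toFinite _), Set.ncard_pair hw.ne, hd]; omega
    obtain ⟨M', h1, h2, h3⟩ := ih (d - 2) (by omega) hM' hcard
    exact ⟨M', h1, h2.trans Set.sdiff_subset, h3⟩

end SimpleGraph

/-! ### From a coloured graph to a configuration -/

namespace ThreeColour

open SimpleGraph

variable {V : Type*} [Fintype V]

/-- There are no configurations. -/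
theorem not_config {W : Type*} [Fintype W] {n k : ℕ} (hk : k < 4) {l : Fin 3 → W → ℕ}
    (h : Config W n k l) : False := by
  have hunused (v : W) : bit (unusedMask k) (vcode l v) = 0 := by
    have key (i : Fin 3) : bit (if Nat.blt i k then 0 else labelMask i 0) (vcode l v) = 0 := by
      split_ifs with hi
      · simp [bit_eq]
      · have h0 : size l (labelMask i 0) = 0 := by
          rw [size_labelMask h.lt i (by norm_num), cnt, Finset.card_eq_zero, Finset.filter_eq_empty_iff]
          exact fun v _ => h.ne_zero i (by simpa [Nat.blt_eq] using hi) v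
        exact (Finset.sum_eq_zero_iff.1 h0) v (Finset.mem_univ v)
    rw [unusedMask, bit_lor_eq_zero, bit_lor_eq_zero]
    exact ⟨key 0, key 1, key 2⟩
  interval_cases k
  · exact false_of_check _ check_treeZero h hunused (by simp)
  · exact false_of_check _ check_treeOne h hunused (by simp)
  · exact false_of_check _ check_treeTwo h hunused (by simp)
  · exact false_of_check _ check_treeThree h hunused (by simp)

lemma cnt_comp_val_le (s : Finset V) (g : V → ℕ) (a : ℕ) :
    cnt (fun v : s => g v) a ≤ cnt g a := by
  refine Finset.card_le_card_of_injOn Subtype.val (fun v hv => ?_) Subtype.val_injective.injOn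
  simpa using hv

open Classical in
/-- A graph in which every matching inside a component has less than `n` vertices can be labelled,
up to few edges at each vertex. -/
lemma exists_labelling (H : SimpleGraph V) {n L : ℕ} (hn : Even n) (hnV : n ≤ Fintype.card V)
    (hL : 0 < L) (hM : ∀ (F : H.ConnectedComponent) (M : H.Subgraph), M.IsMatching →
      M.verts ⊆ F.supp → M.verts.ncard < n)
    {ω : ℕ} (hω : ω = n + 2 * Fintype.card V / L) (s : Finset V) (hs : s.card = 2 * ω + 1) :
    ∃ (b : Bool) (f : s → ℕ), Labelling ω b f ∧
      ∀ v : s, (Finset.univ.filter fun w : s => H.Adj v w ∧ rel b (f v) (f w) = false).card ≤ L := by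
  have hcs : Fintype.card s = 2 * ω + 1 := by simpa using hs
  have hcomp {v w : V} (h : H.Adj v w) : H.connectedComponentMk v = H.connectedComponentMk w :=
    ConnectedComponent.eq.2 h.reachable
  -- Component sizes are counted inside `s`, and `ω` is just under half of its `2ω + 1` vertices. A
  -- component above this threshold leaves at most `ω` vertices for the label `K`.
  by_cases hF : ∀ F : H.ConnectedComponent,
      (Finset.univ.filter fun w : s => H.connectedComponentMk w = F).card ≤ ω
  · obtain ⟨f, hf, hfc⟩ := exists_labelling_of_small hcs (fun v : s => H.connectedComponentMk v)
      (fun v => hF _)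
    refine ⟨false, f, hf, fun v => ?_⟩
    rw [Finset.filter_false_of_mem]
    · simp
    · rintro w - ⟨h1, h2⟩
      simp [rel, hfc v w (hcomp h1)] at h2
  · push Not at hF
    obtain ⟨F, hF⟩ := hF
    -- The edges of `F` alone, on all of `V`. Every matching of `H'` lies in `F`, and the labels of
    -- the isolated vertices outside `F` are overwritten by `3`. Passing to `s` and to `F` only
    -- lowers the counts of `S` and `U`, which are bounded from above.
    let H' : SimpleGraph V :=
      { Adj := fun v w => H.Adj v w ∧ H.connectedComponentMk v = F
        symm := ⟨fun v w h => ⟨h.1.symm, (hcomp h.1).symm.trans h.2⟩⟩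
        loopless := ⟨fun v h => h.1.ne rfl⟩ }
    have hle : H' ≤ H := fun v w h => h.1
    obtain ⟨g, hg3, hgc, hgadj, hgL⟩ := exists_tutteBerge_labels H' hn hnV hL (fun M hMm => by
      have hmap := hMm.map_ofLE hle
      have := hM F _ hmap (by
        intro v hv
        simp only [Subgraph.map_verts, Hom.coe_ofLE, id_eq, Set.image_id'] at hv
        obtain ⟨w, hw, -⟩ := hMm hv
        exact (M.adj_sub hw).2)
      simpa using this)
    let f (v : V) : ℕ := if H.connectedComponentMk v = F then g v else 3
    have hfin {v : V} (h : H.connectedComponentMk v = F) : f v = g v := if_pos h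
    have hfout {v : V} (h : H.connectedComponentMk v ≠ F) : f v = 3 := if_neg h
    have hcnt {a : ℕ} (ha : a < 3) : cnt (fun v : s => f v) a ≤ cnt g a := by
      refine (cnt_comp_val_le s f a).trans (Finset.card_le_card fun v hv => ?_)
      simp only [Finset.mem_filter, Finset.mem_univ, true_and] at hv ⊢
      by_cases h : H.connectedComponentMk v = F
      · rw [← hfin h, hv]
      · rw [hfout h] at hv; omega
    refine ⟨true, fun v => f v, ⟨fun v => ?_, fun _ => ?_, ?_, by simp, by simp, by simp⟩, fun v => ?_⟩
    · have := hg3 v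
      simp only [f]; split_ifs <;> omega
    · have h0 := hcnt (a := 0) (by norm_num)
      have h2 := hcnt (a := 2) (by norm_num)
      omega
    · have h1 := Finset.card_filter_add_card_filter_not (s := (Finset.univ : Finset s))
        (fun w : s => H.connectedComponentMk w = F)
      rw [Finset.card_univ, hcs] at h1
      have h2 : cnt (fun v : s => f v) 3 ≤
          (Finset.univ.filter fun w : s => ¬ H.connectedComponentMk w = F).card := by
        refine Finset.card_le_card fun v hv => ?_
        simp only [Finset.mem_filter, Finset.mem_univ, true_and] at hv ⊢
        intro h
        rw [hfin h] at hv
        have := hg3 v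
        omega
      omega
    -- An edge of the colour can join unrelated labels only if both ends are in `T`.
    · have key (w : s) (h1 : H.Adj v w) (h2 : rel true (f v) (f w) = false) :
          g v = 1 ∧ g w = 1 ∧ H'.Adj v w := by
        by_cases h : H.connectedComponentMk v = F
        · have h' : H.connectedComponentMk w = F := (hcomp h1).symm.trans h
          have hadj : H'.Adj v w := ⟨h1, h⟩
          rw [hfin h, hfin h'] at h2
          have h3 := hg3 v
          have h4 := hg3 w
          have h5 := hgadj v w hadj
          simp only [rel, if_true] at h2
          split_ifs at h2 with h0
          · simp only [decide_eq_false_iff_not, not_and_or, not_not] at h2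
            omega
          · simp only [decide_eq_false_iff_not, not_and_or, not_not] at h2
            rw [not_or] at h0
            have h6 := h5 h0.1 h0.2
            rcases h2 with h2 | h2
            · exact absurd h6 h2
            · exact ⟨h2, h6 ▸ h2, hadj⟩
        · have h' : H.connectedComponentMk w ≠ F := fun h' => h ((hcomp h1).trans h')
          rw [hfout h, hfout h'] at h2
          exact absurd h2 (by decide)
      by_cases hv : g v = 1
      · have hb : (Finset.univ.filter fun w : V => H'.Adj v w ∧ g w = 1).card ≤ L := by
          convert hgL v hv
        refine le_trans ?_ hb
        refine Finset.card_le_card_of_injOn Subtype.val (fun w hw => ?_) Subtype.val_injective.injOn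
        rw [Finset.mem_coe, Finset.mem_filter] at hw
        obtain ⟨-, h1, h2⟩ := key w hw.2.1 hw.2.2
        rw [Finset.mem_coe, Finset.mem_filter]
        exact ⟨Finset.mem_univ _, h2, h1⟩
      · rw [Finset.filter_false_of_mem]
        · simp
        · rintro w - ⟨h1, h2⟩
          exact hv (key w h1 h2).1

/-- A 3-edge-coloured graph with explicit bounds on its order and minimum degree has a matching with
`n` vertices inside a monochromatic component. -/
theorem exists_isMatching_of_bounds {G : SimpleGraph V} [DecidableRel G.Adj] {n L ω : ℕ}
    (hn : Even n) (hL : 0 < L) (hω : ω = n + 2 * Fintype.card V / L)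
    (hcard : 2 * ω + 1 ≤ Fintype.card V)
    (hdeg : 4 * (Fintype.card V + 3 * L) ≤ ω + 4 * G.minDegree) (C : G.EdgeLabeling (Fin 3)) :
    ∃ (i : Fin 3) (F : (C.labelGraph i).ConnectedComponent) (M : (C.labelGraph i).Subgraph),
      M.IsMatching ∧ M.verts ⊆ F.supp ∧ M.verts.ncard = n := by
  classical
  by_contra hcon
  push Not at hcon
  have hlt (i : Fin 3) (F : (C.labelGraph i).ConnectedComponent) (M : (C.labelGraph i).Subgraph)
      (hM : M.IsMatching) (hF : M.verts ⊆ F.supp) : M.verts.ncard < n := by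
    by_contra! hge
    obtain ⟨M', h1, h2, h3⟩ := hM.exists_le_ncard_eq hn (M.verts.ncard - n) (by omega)
    exact hcon i F M' h1 (h2.trans hF) h3
  -- A configuration has exactly `2ω + 1` vertices. Restricting to `s` does not increase the number
  -- of vertices unrelated to a given one.
  obtain ⟨s, -, hs⟩ := Finset.exists_subset_card_eq (s := (Finset.univ : Finset V))
    (n := 2 * ω + 1) (by rwa [Finset.card_univ])
  have hnω : n ≤ ω := hω ▸ Nat.le_add_right _ _
  choose b f hf hfL using fun i : Fin 3 =>
    exists_labelling (C.labelGraph i) hn (by omega) hL (hlt i) hω s hs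
  obtain ⟨k, hk, l, hl⟩ := exists_config (by simpa using hs) hf fun v => by
    -- An edge between unrelated vertices is a discarded edge of its own colour, so there are at
    -- most `3L` of these at `v`, besides at most `|V| - δ(G)` non-neighbours.
    have h1 : (Finset.univ.filter fun w : s => ∀ i, rel (b i) (f i v) (f i w) = false) ⊆
        (Finset.univ.filter fun w : s => ¬ G.Adj v w) ∪ Finset.univ.biUnion fun i : Fin 3 =>
          Finset.univ.filter fun w : s => (C.labelGraph i).Adj v w ∧
            rel (b i) (f i v) (f i w) = false := by
      intro w hw
      simp only [Finset.mem_filter, Finset.mem_univ, true_and, Finset.mem_union,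
        Finset.mem_biUnion] at hw ⊢
      by_cases h : G.Adj v w
      · exact Or.inr ⟨C ⟨s(v.1, w.1), h⟩, (EdgeLabeling.labelGraph_adj _ _).2 ⟨h, rfl⟩, hw _⟩
      · exact Or.inl h
    have h2 := (Finset.card_le_card h1).trans (Finset.card_union_le _ _)
    have h3 : (Finset.univ.biUnion fun i : Fin 3 => Finset.univ.filter fun w : s =>
        (C.labelGraph i).Adj v w ∧ rel (b i) (f i v) (f i w) = false).card ≤ 3 * L := by
      refine Finset.card_biUnion_le.trans
        ((Finset.sum_le_card_nsmul _ _ L fun i _ => ?_).trans (by simp))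
      refine le_trans (le_of_eq ?_) (hfL i v)
      congr
    have h4 : (Finset.univ.filter fun w : s => ¬ G.Adj v w).card + G.minDegree
        ≤ Fintype.card V := by
      have h5 : (Finset.univ.filter fun w : s => ¬ G.Adj v w).card ≤
          (Finset.univ.filter fun w : V => ¬ G.Adj v w).card := by
        refine Finset.card_le_card_of_injOn Subtype.val (fun w hw => ?_)
          Subtype.val_injective.injOn
        simpa using hw
      have h6 := Finset.card_filter_add_card_filter_not (s := (Finset.univ : Finset V))
        (fun w => G.Adj v w)
      have h7 : (Finset.univ.filter fun w : V => G.Adj v w).card = G.degree v := by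
        rw [← card_neighborFinset_eq_degree]
        congr 1; ext w; simp
      have h8 := G.minDegree_le_degree v
      rw [Finset.card_univ] at h6
      omega
    omega
  exact not_config hk hl

end ThreeColour

theorem theorem3 :
    ∀ η : ℝ, 0 < η → ∃ n₀ : ℕ, ∀ n : ℕ, n₀ ≤ n → Even n →
      ∀ (V : Type*) [Fintype V] (G : SimpleGraph V) [DecidableRel G.Adj],
        |(Fintype.card V : ℝ) - (2 + η) * n| < 1 →
        (7 / 4 + 4 * η) * n ≤ (G.minDegree : ℝ) →
        ∀ C : G.EdgeLabeling (Fin 3),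
          ∃ (i : Fin 3) (F : (C.labelGraph i).ConnectedComponent)
            (M : (C.labelGraph i).Subgraph),
            M.IsMatching ∧ M.verts ⊆ F.supp ∧ M.verts.ncard = n := by
  intro η hη
  -- The bound `η n ≥ 16/η + 14` is what `2ω + 1 ≤ N` requires: `ω ≤ n + 8/η + 6`, and rounding may
  -- bring `N` down to almost `(2 + η)n - 1`.
  refine ⟨⌈(16 / η + 14) / η⌉₊, fun n hn hev V _ G _ hN hδ C => ?_⟩
  have hηn : 16 / η + 14 ≤ η * n := by
    have := (div_le_iff₀ hη).1 ((Nat.le_ceil _).trans (Nat.cast_le.2 hn))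
    linarith
  have hpos : 0 < 16 / η := by positivity
  obtain ⟨hN1, hN2⟩ := abs_lt.1 hN
  set N := Fintype.card V with hNdef
  -- `L` is linear in `n`, so the error `2N / L` stays bounded, yet small enough that `3L`, about
  -- `3ηn/2`, fits into the slack `3ηn` of the degree condition.
  set L := ⌊η * n / 2⌋₊ + 1 with hLdef
  have hL1 : η * n / 2 < (L : ℝ) := by rw [hLdef]; push_cast; exact Nat.lt_floor_add_one _
  have hL2 : (L : ℝ) ≤ η * n / 2 + 1 := by
    rw [hLdef]; push_cast
    have := Nat.floor_le (a := η * n / 2) (by positivity)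
    linarith
  have hdiv : ((2 * N / L : ℕ) : ℝ) ≤ 8 / η + 6 := by
    refine Nat.cast_div_le.trans ?_
    rw [div_le_iff₀ (by linarith)]
    push_cast
    have h1 : (8 / η + 6) * (η * n / 2) ≤ (8 / η + 6) * L :=
      mul_le_mul_of_nonneg_left hL1.le (by positivity)
    have h2 : (8 / η + 6) * (η * n / 2) = 4 * n + 3 * (η * n) := by field_simp; ring
    nlinarith
  refine ThreeColour.exists_isMatching_of_bounds hev (L := L) (Nat.succ_pos _) rfl ?_ ?_ C
  · have : ((2 * (n + 2 * N / L) + 1 : ℕ) : ℝ) ≤ N := by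
      push_cast
      have e : 16 / η = 2 * (8 / η) := by ring
      linarith
    exact_mod_cast this
  · have : ((4 * (N + 3 * L) : ℕ) : ℝ) ≤ ((n + 4 * G.minDegree : ℕ) : ℝ) := by
      push_cast
      nlinarith
    have : 4 * (N + 3 * L) ≤ n + 4 * G.minDegree := by exact_mod_cast this
    -- The degree condition holds already with `n` in place of the larger `ω`.
    exact this.trans (Nat.add_le_add_right (Nat.le_add_right _ _) _)
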